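/- Let $\mathcal H$ be a separable infinite-dimensional complex Hilbert space, with a decreasing flag of closed complex subspaces $\mathcal H=W_0\supset W_1\supset\cdots$, $\operatorname{codim}_{\mathbb C}W_j=j$, $\bigcap_j W_j=0$. Let $k\ge 0$, let $\mathrm{Fred}_k$ be the space of bounded Fredholm operators on $\mathcal H$ of index $k$ (an open subset of the Banach space of bounded operators), let $\lambda=(\lambda_1\ge\dots\ge\lambda_k\ge0)$ be a partition, $|\lambda|=\sum_i\lambda_i$, and put $$\Sigma^{(k)}_\lambda=\{T\in\mathrm{Fred}_k \mid \dim_{\mathbb C}(\operatorname{Ker}T\cap W_{\lambda_i+k-i})\ge i,\ i=1,\dots,k\}.$$ For a strictly increasing sequence $J=(j_0<\dots<j_{r-1})$ of non-negative integers, an $r$-dimensional subspace $V\subset\mathcal H$ has exact type $J$ if $\dim(V\cap W_{j_q})=r-q$ and $\dim(V\cap W_{j_q+1})=r-q-1$ for $q=0,\dots,r-1$. Let $\Sigma^{(k),\circ}_J$ be the set of $T\in\mathrm{Fred}_k$ whose kernel has exact type $J$, and let $J(T)$ be the exact type of $\operatorname{Ker}T$. Put $N_k(J)=r(r-k)+\sum_{q}(j_q-q)$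 and $J^{(k)}_\lambda=(\lambda_k,\lambda_{k-1}+1,\dots,\lambda_1+k-1)$. Write $J\succeq_k\lambda$ if $r\ge k$ and $j_{r-i}\ge\lambda_i+k-i$ for $i=1,\dots,k$. A quasi-manifold of codimension $c$ in a Banach manifold $X$ is a closed subset $W$ with a decreasing filtration by closed subsets $W=F_0\supset F_1\supset F_2\supset\cdots$ such that $F_1=F_2$ and every stratum $S_m=F_m\setminus F_{m+1}$ is empty or a smooth Banach submanifold of $X$ of real codimension $c+m$. It is cooriented if the normal bundle of the top stratum $S_0$ is oriented. **Theorem.** The filtration $F_0=\Sigma^{(k)}_\lambda$, $F_{2m-1}=F_{2m}=\{T\in\Sigma^{(k)}_\lambda\mid N_k(J(T))\ge|\lambda|+m\}$ $(m\ge1)$ makes $\Sigma^{(k)}_\lambda\subset\mathrm{Fred}_k$ a cooriented quasi-manifold of real codimension $2|\lambda|$, cooriented by the canonical orientation of the normal spaces of $S_0$, which are complex vector spaces. Its strata are $$S_{2\ell+1}=\varnothing,\qquad S_{2\ell}=\bigsqcup_{J\succeq_k\lambda,\ N_k(J)=|\lambda|+\ell}\Sigma^{(k),\circ}_J\qquad(\ell\ge0),$$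 and its top stratum is $$S_0=\Sigma^{(k),\circ}_{J^{(k)}_\lambda}=\{T\in\mathrm{Fred}_k\mid \dim\operatorname{Ker}T=k,\ \operatorname{Coker}T=0,\ \operatorname{Ker}T\text{ has exact type }J^{(k)}_\lambda\}.$$ In particular every $T\in S_0$ is surjective. -/

import Mathlib

open scoped ContDiff Topology

noncomputable section

namespace SchurKoschorke

/-! ### Submanifolds of open subsets of a Banach space, and their normal bundles -/

section Submanifold

variable {E : Type*} [NormedAddCommGroup E] [NormedSpace ℝ E]

/-- `φ` is a smooth chart of the open set `X ⊆ E` (a `C^∞` diffeomorphism from an open subset of `X`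
onto an open subset of the model space `E`) which straightens `S` to the closed subspace `F`. -/
structure IsAdaptedChart (X S : Set E) (φ : OpenPartialHomeomorph E E) (F : Submodule ℝ E) :
    Prop where
  source_subset : φ.source ⊆ X
  contDiffOn : ContDiffOn ℝ ∞ φ φ.source
  contDiffOn_symm : ContDiffOn ℝ ∞ φ.symm φ.target
  isClosed : IsClosed (F : Set E)
  mem_iff : ∀ x ∈ φ.source, x ∈ S ↔ φ x ∈ F

/-- `S` is a (split, smooth, not necessarily closed) Banach submanifold of real codimension `c` of
the open set `X ⊆ E`. A closed subspace of finite codimension is complemented, so that the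
splitting is automatic. -/
def IsSubmanifold (X S : Set E) (c : ℕ) : Prop :=
  S ⊆ X ∧ ∀ p ∈ S, ∃ (φ : OpenPartialHomeomorph E E) (F : Submodule ℝ E),
    p ∈ φ.source ∧ IsAdaptedChart X S φ F ∧ Module.rank ℝ (E ⧸ F) = c

/-- The tangent space of `S ⊆ E` at `p`: the span of the velocities at `p` of the curves in `S`.
For a submanifold the velocities already form a subspace. -/
def tangentSubspace (S : Set E) (p : E) : Submodule ℝ E :=
  Submodule.span ℝ {v | ∃ γ : ℝ → E, γ 0 = p ∧ (∀ᶠ t in 𝓝 0, γ t ∈ S) ∧ HasDerivAt γ v 0}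

/-- The fibre at `p` of the normal bundle of `S` in an open subset of `E`. -/
abbrev NormalSpace (S : Set E) (p : E) : Type _ := E ⧸ tangentSubspace S p

/-- A family of orientations of the fibres of the normal bundle of `S` is an orientation of the
normal bundle if around every point it is constant in the trivialization `N_q S ≃ E ⧸ F`
that the derivatives of some adapted chart induce. -/
def IsNormalOrientation (X S : Set E) (c : ℕ)
    (orient : ∀ p : S, Orientation ℝ (NormalSpace S (p : E)) (Fin c)) : Prop :=
  ∀ p : S, ∃ (φ : OpenPartialHomeomorph E E) (F : Submodule ℝ E),
    (p : E) ∈ φ.source ∧ IsAdaptedChart X S φ F ∧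
    ∃ o : Orientation ℝ (E ⧸ F) (Fin c), ∀ q : S, (q : E) ∈ φ.source →
      ∃ e : NormalSpace S (q : E) ≃ₗ[ℝ] (E ⧸ F),
        (∀ v : E, e (Submodule.Quotient.mk v) = Submodule.Quotient.mk (fderiv ℝ φ q v)) ∧
        Orientation.map (Fin c) e (orient q) = o

/-- `o` is the canonical orientation of the complex vector space `E ⧸ T`, where `T` is a complex
subspace: the one given by the real basis `v₀, i v₀, v₁, i v₁, …` for a complex basis `v₀, v₁, …`. -/
def IsComplexOrientation [NormedSpace ℂ E] [IsScalarTower ℝ ℂ E] (T : Submodule ℝ E) (n : ℕ)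
    (o : Orientation ℝ (E ⧸ T) (Fin (2 * n))) : Prop :=
  (∀ x ∈ T, Complex.I • x ∈ T) ∧
  ∃ (v : Fin n → E) (b : Module.Basis (Fin (2 * n)) ℝ (E ⧸ T)),
    (∀ i : Fin n,
      b ⟨2 * (i : ℕ), by omega⟩ = Submodule.Quotient.mk (v i) ∧
      b ⟨2 * (i : ℕ) + 1, by omega⟩ = Submodule.Quotient.mk (Complex.I • v i)) ∧
    b.orientation = o

/-- A cooriented quasi-manifold structure of codimension `c` on a closed subset `W` of the
Banach manifold `X`, where `X` is an open subset of the Banach space `E`. -/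
structure CoorientedQuasiManifold (X W : Set E) (c : ℕ) where
  isOpen : IsOpen X
  subset : W ⊆ X
  /-- The filtration `W = F₀ ⊇ F₁ ⊇ F₂ ⊇ ⋯`. -/
  filtration : ℕ → Set E
  filtration_zero : filtration 0 = W
  antitone : Antitone filtration
  /-- Every `F_m` is closed in `X`. -/
  isClosed : ∀ m, IsClosed (Subtype.val ⁻¹' filtration m : Set X)
  filtration_one : filtration 1 = filtration 2
  stratum : ∀ m, filtration m \ filtration (m + 1) = ∅ ∨
    IsSubmanifold X (filtration m \ filtration (m + 1)) (c + m)
  /-- The coorientation: an orientation of the normal bundle of the top stratum. -/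
  coorientation : ∀ p : (filtration 0 \ filtration 1 : Set E),
    Orientation ℝ (NormalSpace (filtration 0 \ filtration 1) (p : E)) (Fin c)
  isNormalOrientation :
    IsNormalOrientation X (filtration 0 \ filtration 1) c coorientation

/-- The stratum `S_m = F_m \ F_{m+1}`. -/
def CoorientedQuasiManifold.S {X W : Set E} {c : ℕ} (Q : CoorientedQuasiManifold X W c) (m : ℕ) :
    Set E :=
  Q.filtration m \ Q.filtration (m + 1)

end Submanifold

/-! ### Schubert types -/

/-- A finite strictly increasing sequence `j₀ < j₁ < ⋯ < j_{r-1}` of natural numbers, `r ≥ 0`. -/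
structure SchubertType where
  length : ℕ
  entry : Fin length → ℕ
  strictMono : StrictMono entry

/-- `N_k(J) = r (r - k) + ∑_q (j_q - q)`. -/
def SchubertType.N (k : ℕ) (J : SchubertType) : ℤ :=
  (J.length : ℤ) * ((J.length : ℤ) - (k : ℤ)) +
    ∑ q : Fin J.length, ((J.entry q : ℤ) - ((q : ℕ) : ℤ))

/-- `J` `k`-dominates `λ`: one has `r ≥ k` and `j_{r-i} ≥ λ_i + k - i` for `i = 1, …, k`
(in the code the index `i` starts at `0`). -/
def SchubertType.Dominates {k : ℕ} (J : SchubertType) (lam : Fin k → ℕ) : Prop :=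
  ∃ h : k ≤ J.length, ∀ i : Fin k,
    lam i + (k - 1 - (i : ℕ)) ≤ J.entry ⟨J.length - 1 - (i : ℕ), by omega⟩

/-- `J_λ^{(k)} = (λ_k, λ_{k-1} + 1, …, λ_1 + k - 1)`. -/
def SchubertType.ofPartition {k : ℕ} (lam : Fin k → ℕ) (hlam : Antitone lam) : SchubertType where
  length := k
  entry q := lam (Fin.rev q) + (q : ℕ)
  strictMono := fun a b hab => by
    have h1 : lam (Fin.rev a) ≤ lam (Fin.rev b) := hlam (Fin.rev_le_rev.mpr hab.le)
    have h2 : (a : ℕ) < (b : ℕ) := hab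
    show lam (Fin.rev a) + (a : ℕ) < lam (Fin.rev b) + (b : ℕ)
    omega

/-! ### Fredholm operators and Schur–Koschorke loci -/

section Fredholm

variable {H : Type*} [NormedAddCommGroup H] [InnerProductSpace ℂ H]

/-- The Fredholm index `dim Ker T - dim Coker T`. -/
def index (T : H →L[ℂ] H) : ℤ :=
  (Module.finrank ℂ T.ker : ℤ) - (Module.finrank ℂ (H ⧸ T.range) : ℤ)

variable (H) in
/-- `Fred_p(H)`: the bounded Fredholm operators of index `p` on `H`. The type `H →L[ℂ] H` carries
the operator norm. -/
def Fred (p : ℤ) : Set (H →L[ℂ] H) :=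
  {T | T.IsFredholm ∧ index T = p}

variable (H) in
/-- A complete decreasing flag `H = W₀ ⊃ W₁ ⊃ W₂ ⊃ ⋯` of closed complex subspaces with
`codim W_j = j` and `⋂ W_j = 0`. -/
structure CompleteFlag where
  W : ℕ → Submodule ℂ H
  zero : W 0 = ⊤
  antitone : Antitone W
  isClosed : ∀ j, IsClosed (W j : Set H)
  codim : ∀ j, Module.rank ℂ (H ⧸ W j) = j
  iInf_eq_bot : ⨅ j, W j = ⊥

/-- The Schur–Koschorke locus: `T ∈ Fred_k` with `dim (Ker T ∩ W_{λ_i + k - i}) ≥ i` for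
`i = 1, …, k` (in the code the index `i` starts at `0`). -/
def locus (W : CompleteFlag H) {k : ℕ} (lam : Fin k → ℕ) : Set (H →L[ℂ] H) :=
  {T | T ∈ Fred H k ∧ ∀ i : Fin k,
    (i : ℕ) + 1 ≤
      Module.finrank ℂ (T.ker ⊓ W.W (lam i + (k - 1 - (i : ℕ))) : Submodule ℂ H)}

/-- The finite-dimensional subspace `V` has exact type `J` with respect to the flag. -/
structure HasExactType (W : CompleteFlag H) (V : Submodule ℂ H) (J : SchubertType) : Prop where
  finiteDimensional : FiniteDimensional ℂ V
  finrank_eq : Module.finrank ℂ V = J.length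
  finrank_inf : ∀ q : Fin J.length,
    Module.finrank ℂ (V ⊓ W.W (J.entry q) : Submodule ℂ H) = J.length - (q : ℕ)
  finrank_inf_succ : ∀ q : Fin J.length,
    Module.finrank ℂ (V ⊓ W.W (J.entry q + 1) : Submodule ℂ H) = J.length - (q : ℕ) - 1

/-- The exact stratum: `T ∈ Fred_k` whose kernel has exact type `J`. -/
def exactStratum (W : CompleteFlag H) (k : ℕ) (J : SchubertType) : Set (H →L[ℂ] H) :=
  {T | T ∈ Fred H k ∧ HasExactType W T.ker J}

/-- The standard filtration: `F₀` is the Schur–Koschorke locus and, for `m ≥ 1`,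
`F_{2m-1} = F_{2m}` is the set of its elements `T` with `N_k(J(T)) ≥ |λ| + m`, where `J(T)` is the
exact type of `Ker T`. -/
def standardFiltration (W : CompleteFlag H) {k : ℕ} (lam : Fin k → ℕ) : ℕ → Set (H →L[ℂ] H)
  | 0 => locus W lam
  | n + 1 => {T | T ∈ locus W lam ∧ ∃ J : SchubertType, HasExactType W T.ker J ∧
      (∑ i, lam i : ℕ) + ((n / 2 + 1 : ℕ) : ℤ) ≤ J.N k}

end Fredholm

end SchurKoschorke

end

/-!
Let `t` be a Fredholm operator of index `k` whose kernel has exact type `J`. A generalized inverse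
`g` of `t` decomposes the source as `Ker t ⊕ M` and the target as `C ⊕ Im t`, and the operators `x`
near `t` are `2 × 2` blocks with an invertible block from `M` to `Im t`. By elimination,
`Ker x` is the graph, over the kernel of the Schur complement `Ker t → C`, of a linear map from
`Ker t` to `M`, the slope of `x`. Replacing the first column of `x` by the Schur complement and the
slope is a holomorphic chart with a polynomial inverse (`IsGeneralizedInverse.chart`); these are
identities in a ring. They also show that Fredholm operators of index `k` form an open set
(`isOpen_Fred`), and that the dimensions of `Ker x ∩ W_j` are upper semicontinuous in `x`
(`IsAdaptedSequence.eventually_forall_finrank_inf_le`).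

Choose an orthonormal sequence `e` with `W_j = {e_0, …, e_{j-1}}ᗮ`, and for `M` the common kernel
of the functionals `⟪e_j, ·⟫`, `j` an entry of `J`, which are coordinates on `Ker t`. In the chart
the stratum of type `J` is then a linear subspace: the Schur complement vanishes, and the reduced
echelon basis of `Ker t`, moved by the slope, is still in echelon form (`mem_exactStratum_iff`).
The first condition has complex codimension `r (r - k)` and the second one `∑ (j_q - q)`, in total
`N_k(J)`.

The number `N_k` is strictly monotone in the type (`SchubertType.N_le_N`). With semicontinuity this
gives the closedness of the filtration and shows that near a point of a stratum only one exact type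
has the same `N_k`. Since `ofPartition lam` is the smallest type that dominates `lam`, it also
identifies the top stratum. The charts are holomorphic and straighten to complex subspaces, so the
normal spaces are complex and the trivializations of the normal bundle are complex linear; a complex
linear isomorphism preserves the canonical orientations (`orientation_eq_of_complex`).
-/

noncomputable section

namespace SchurKoschorke

/-! ### Generalized inverses and the block chart, in a ring -/

section GeneralizedInverse

/-- `g` is a reflexive generalized inverse of `t`. Then `1 - g * t` and `1 - t * g` are idempotents;
for operators they are a projection onto `Ker t` and a projection along `Im t`, written `p` and `q`
in the names below. -/
structure IsGeneralizedInverse {A : Type*} [Ring A] (t g : A) : Prop where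
  tgt : t * g * t = t
  gtg : g * t * g = g

variable {A : Type*} [Ring A]

/-- The element `p + g x (1 - p)`, where `p = 1 - g t`. It is invertible exactly when the corner of
`x` from `Ker p` to `Ker q` is; for `x = t` this corner is the isomorphism from the complement
`Ker p` of `Ker t` onto `Im t`. -/
def pivot (t g x : A) : A := (1 - g * t) + g * x * (g * t)

/-- The linear map from `Im p` to `Ker p` whose graph is the space of `v` with `g x v = 0`, extended
by `0` to `Ker p`. The kernel of `x` lies on this graph. `Ring.inverse` takes the junk value `0` off
the units, so that `slope` is meaningful only where `pivot t g x` is invertible. -/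
def slope (t g x : A) : A := -(Ring.inverse (pivot t g x) * g * x * (1 - g * t))

/-- The block coordinates of `x`: with respect to the decompositions given by `p` in the source and
`q` in the target, the corner of `x` from `Im p` to `Im q` is replaced by its Schur complement, the
corner from `Im p` to `Ker q` by `t * slope t g x`, and the other two corners are kept. -/
def blockChart (t g x : A) : A := x * (1 + slope t g x) + t * slope t g x

/-- The inverse of `blockChart`, a polynomial: the slope of `blockChartSymm t g y` is
`g * y * (1 - g * t)`. -/
def blockChartSymm (t g y : A) : A :=
  (y - t * (g * y * (1 - g * t))) * (1 - g * y * (1 - g * t))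

variable {t g x y : A}

lemma pivot_self (h : IsGeneralizedInverse t g) : pivot t g t = 1 := by
  have := h.tgt
  calc pivot t g t = 1 - g * t + g * (t * g * t) := by unfold pivot; noncomm_ring
    _ = 1 := by rw [this]; noncomm_ring

namespace IsGeneralizedInverse

variable (h : IsGeneralizedInverse t g)
include h

lemma p_mul_g : (1 - g * t) * g = 0 := by
  have := h.gtg; rw [sub_mul, this, one_mul, sub_self]

lemma t_mul_p : t * (1 - g * t) = 0 := by
  have := h.tgt; rw [mul_sub, ← mul_assoc, this, mul_one, sub_self]

lemma g_mul_q : g * (1 - t * g) = 0 := by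
  have := h.gtg; rw [mul_sub, ← mul_assoc, this, mul_one, sub_self]

lemma q_mul_t : (1 - t * g) * t = 0 := by
  have := h.tgt; rw [sub_mul, this, one_mul, sub_self]

lemma p_mul_p : (1 - g * t) * (1 - g * t) = 1 - g * t := by
  rw [sub_mul _ _ (1 - g * t), mul_assoc, h.t_mul_p]; simp

lemma q_mul_q : (1 - t * g) * (1 - t * g) = 1 - t * g := by
  rw [sub_mul _ _ (1 - t * g), mul_assoc, h.g_mul_q]; simp

lemma p_mul_pivot : (1 - g * t) * pivot t g x = 1 - g * t := by
  calc (1 - g * t) * pivot t g x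
      = (1 - g * t) * (1 - g * t) + ((1 - g * t) * g) * x * (g * t) := by
        unfold pivot; noncomm_ring
    _ = _ := by rw [h.p_mul_p, h.p_mul_g]; noncomm_ring

lemma pivot_mul_p : pivot t g x * (1 - g * t) = 1 - g * t := by
  calc pivot t g x * (1 - g * t)
      = (1 - g * t) * (1 - g * t) + g * x * g * (t * (1 - g * t)) := by
        unfold pivot; noncomm_ring
    _ = _ := by rw [h.p_mul_p, h.t_mul_p]; noncomm_ring

lemma p_mul_inverse (hx : IsUnit (pivot t g x)) :
    (1 - g * t) * Ring.inverse (pivot t g x) = 1 - g * t := by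
  have := h.p_mul_pivot (x := x)
  calc _ = ((1 - g * t) * pivot t g x) * Ring.inverse (pivot t g x) := by rw [this]
    _ = _ := by rw [mul_assoc, Ring.mul_inverse_cancel _ hx, mul_one]

lemma inverse_mul_p (hx : IsUnit (pivot t g x)) :
    Ring.inverse (pivot t g x) * (1 - g * t) = 1 - g * t := by
  have := h.pivot_mul_p (x := x)
  calc _ = Ring.inverse (pivot t g x) * (pivot t g x * (1 - g * t)) := by rw [this]
    _ = _ := by rw [← mul_assoc, Ring.inverse_mul_cancel _ hx, one_mul]

lemma slope_mul_p : slope t g x * (1 - g * t) = slope t g x := by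
  unfold slope; rw [neg_mul, mul_assoc _ (1 - g * t), h.p_mul_p]

lemma slope_mul_g : slope t g x * g = 0 := by
  unfold slope; rw [neg_mul, mul_assoc _ (1 - g * t), h.p_mul_g, mul_zero, neg_zero]

lemma p_mul_slope (hx : IsUnit (pivot t g x)) : (1 - g * t) * slope t g x = 0 := by
  calc (1 - g * t) * slope t g x
      = -((1 - g * t) * Ring.inverse (pivot t g x) * g * x * (1 - g * t)) := by
        unfold slope; noncomm_ring
    _ = 0 := by rw [h.p_mul_inverse hx, h.p_mul_g]; simp

lemma g_mul_t_mul_slope (hx : IsUnit (pivot t g x)) : g * (t * slope t g x) = slope t g x := by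
  have := h.p_mul_slope hx
  rw [sub_mul, one_mul, sub_eq_zero] at this
  rw [← mul_assoc, ← this]

lemma slope_mul_slope (hx : IsUnit (pivot t g x)) : slope t g x * slope t g x = 0 := by
  calc _ = slope t g x * (1 - g * t) * slope t g x := by rw [h.slope_mul_p]
    _ = 0 := by rw [mul_assoc, h.p_mul_slope hx, mul_zero]

lemma g_mul_x_mul_inverse_mul_g (hx : IsUnit (pivot t g x)) :
    g * x * Ring.inverse (pivot t g x) * g = g := by
  set r := Ring.inverse (pivot t g x)
  have h1 : (1 - g * t) * r = 1 - g * t := h.p_mul_inverse hx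
  calc g * x * r * g = (g * x * (g * t)) * r * g + g * x * ((1 - g * t) * r) * g := by noncomm_ring
    _ = (pivot t g x - (1 - g * t)) * r * g + g * x * ((1 - g * t) * g) := by
        rw [h1]; unfold pivot; noncomm_ring
    _ = (pivot t g x * r) * g - ((1 - g * t) * r) * g := by rw [h.p_mul_g]; noncomm_ring
    _ = g := by rw [Ring.mul_inverse_cancel _ hx, h1, h.p_mul_g]; simp

lemma g_mul_x_mul_slope (hx : IsUnit (pivot t g x)) :
    g * x * slope t g x = -(g * x * (1 - g * t)) := by
  calc g * x * slope t g x
      = -((g * x * Ring.inverse (pivot t g x) * g) * x * (1 - g * t)) := by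
        rw [slope]; noncomm_ring
    _ = _ := by rw [h.g_mul_x_mul_inverse_mul_g hx]

lemma g_mul_blockChart_mul_p (hx : IsUnit (pivot t g x)) :
    g * blockChart t g x * (1 - g * t) = slope t g x := by
  calc g * blockChart t g x * (1 - g * t)
      = g * x * (1 - g * t) + g * x * (slope t g x * (1 - g * t))
        + g * (t * (slope t g x * (1 - g * t))) := by unfold blockChart; noncomm_ring
    _ = slope t g x := by
        rw [h.slope_mul_p, h.g_mul_x_mul_slope hx, h.g_mul_t_mul_slope hx]; simp

lemma blockChart_mul_g : blockChart t g x * g = x * g := by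
  calc blockChart t g x * g = x * g + x * (slope t g x * g) + t * (slope t g x * g) := by
        unfold blockChart; noncomm_ring
    _ = x * g := by rw [h.slope_mul_g]; simp

lemma pivot_blockChart : pivot t g (blockChart t g x) = pivot t g x := by
  have := h.blockChart_mul_g (x := x)
  calc pivot t g (blockChart t g x) = (1 - g * t) + g * (blockChart t g x * g) * t := by
        unfold pivot; noncomm_ring
    _ = _ := by rw [this]; unfold pivot; noncomm_ring

lemma blockChartSymm_blockChart (hx : IsUnit (pivot t g x)) :
    blockChartSymm t g (blockChart t g x) = x := by
  unfold blockChartSymm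
  rw [h.g_mul_blockChart_mul_p hx]
  calc (blockChart t g x - t * slope t g x) * (1 - slope t g x)
      = x - x * (slope t g x * slope t g x) := by unfold blockChart; noncomm_ring
    _ = x := by rw [h.slope_mul_slope hx]; simp

lemma blockChartSymm_mul_g : blockChartSymm t g y * g = y * g := by
  calc blockChartSymm t g y * g
      = (y - t * (g * y * (1 - g * t))) * (g - g * y * ((1 - g * t) * g)) := by
        unfold blockChartSymm; noncomm_ring
    _ = y * g := by
        rw [h.p_mul_g, mul_zero, sub_zero, sub_mul]
        simp only [mul_assoc, h.p_mul_g, mul_zero, sub_zero]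

lemma pivot_blockChartSymm : pivot t g (blockChartSymm t g y) = pivot t g y := by
  have := h.blockChartSymm_mul_g (y := y)
  calc pivot t g (blockChartSymm t g y) = (1 - g * t) + g * (blockChartSymm t g y * g) * t := by
        unfold pivot; noncomm_ring
    _ = _ := by rw [this]; unfold pivot; noncomm_ring

lemma slope_blockChartSymm (hy : IsUnit (pivot t g y)) :
    slope t g (blockChartSymm t g y) = g * y * (1 - g * t) := by
  have hsp : g * y * (1 - g * t) * (1 - g * t) = g * y * (1 - g * t) := by
    rw [mul_assoc, h.p_mul_p]
  have hps : (1 - g * t) * (g * y * (1 - g * t)) = 0 := by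
    rw [← mul_assoc, ← mul_assoc, h.p_mul_g]; simp
  have hgts : g * (t * (g * y * (1 - g * t))) = g * y * (1 - g * t) := by
    rw [sub_mul, one_mul, sub_eq_zero] at hps
    rw [← mul_assoc, ← hps]
  have hss : g * y * (1 - g * t) * (g * y * (1 - g * t)) = 0 := by
    rw [mul_assoc (g * y), hps, mul_zero]
  have key : g * blockChartSymm t g y * (1 - g * t)
      = -(pivot t g y * (g * y * (1 - g * t))) := by
    set s := g * y * (1 - g * t) with hs
    have h1 : blockChartSymm t g y = (y - t * s) * (1 - s) := rfl
    calc g * blockChartSymm t g y * (1 - g * t)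
        = (g * y - g * (t * s)) * ((1 - g * t) - s * (1 - g * t)) := by rw [h1]; noncomm_ring
      _ = (g * y - s) * ((1 - g * t) - s) := by rw [hgts, hsp]
      _ = g * y * (1 - g * t) - g * y * s - s * (1 - g * t) + s * s := by
          generalize 1 - g * t = p
          noncomm_ring
      _ = -(g * y * (g * (t * s))) := by rw [hss, hsp, ← hs, hgts]; noncomm_ring
      _ = -((pivot t g y - (1 - g * t)) * s) := by unfold pivot; noncomm_ring
      _ = _ := by rw [sub_mul, hps, sub_zero]
  unfold slope
  rw [h.pivot_blockChartSymm]
  calc _ = -(Ring.inverse (pivot t g y) * (g * blockChartSymm t g y * (1 - g * t))) := by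
        simp only [mul_assoc]
    _ = _ := by
        rw [key, mul_neg, neg_neg, ← mul_assoc, Ring.inverse_mul_cancel _ hy, one_mul]

lemma blockChart_blockChartSymm (hy : IsUnit (pivot t g y)) :
    blockChart t g (blockChartSymm t g y) = y := by
  have hss : g * y * (1 - g * t) * (g * y * (1 - g * t)) = 0 := by
    calc _ = g * y * ((1 - g * t) * g) * y * (1 - g * t) := by noncomm_ring
      _ = 0 := by rw [h.p_mul_g]; simp
  unfold blockChart
  rw [h.slope_blockChartSymm hy, blockChartSymm]
  set s := g * y * (1 - g * t)
  calc _ = y - (y - t * s) * (s * s) := by noncomm_ring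
    _ = y := by rw [hss]; simp

/-- Composing `x` with the unipotent element `1 + slope t g x` leaves only the Schur complement on
`Im p`. -/
lemma mul_one_add_slope (hx : IsUnit (pivot t g x)) :
    x * (1 + slope t g x) = x * g * t + (1 - t * g) * blockChart t g x * (1 - g * t) := by
  have h1 := h.g_mul_blockChart_mul_p hx
  have h2 := h.blockChart_mul_g (x := x)
  calc x * (1 + slope t g x) = blockChart t g x - t * slope t g x := by
        unfold blockChart; noncomm_ring
    _ = blockChart t g x - t * (g * blockChart t g x * (1 - g * t)) := by rw [h1]
    _ = (blockChart t g x * g) * t + (1 - t * g) * blockChart t g x * (1 - g * t) := by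
        noncomm_ring
    _ = _ := by rw [h2]

lemma g_mul_mul_one_add_slope (hx : IsUnit (pivot t g x)) :
    g * (x * (1 + slope t g x)) = pivot t g x - (1 - g * t) := by
  rw [h.mul_one_add_slope hx, mul_add, ← mul_assoc g ((1 - t * g) * _), ← mul_assoc g (1 - t * g),
    h.g_mul_q]
  unfold pivot; noncomm_ring

lemma inverse_mul_g_mul (hx : IsUnit (pivot t g x)) :
    Ring.inverse (pivot t g x) * g * x = 1 - (1 + slope t g x) * (1 - g * t) := by
  set r := Ring.inverse (pivot t g x) with hr
  calc r * g * x = r * (g * x * (g * t)) + r * g * x * (1 - g * t) := by noncomm_ring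
    _ = r * (pivot t g x - (1 - g * t)) - slope t g x := by unfold pivot slope; noncomm_ring
    _ = 1 - (1 - g * t) - slope t g x := by
        rw [mul_sub, Ring.inverse_mul_cancel _ hx, h.inverse_mul_p hx]
    _ = 1 - (1 - g * t) - slope t g x * (1 - g * t) := by rw [h.slope_mul_p]
    _ = _ := by noncomm_ring

lemma mul_inverse_mul_g (hx : IsUnit (pivot t g x)) :
    x * (Ring.inverse (pivot t g x) * g)
      = 1 - (1 - t * g) * (1 - x * (Ring.inverse (pivot t g x) * g)) := by
  have := h.g_mul_x_mul_inverse_mul_g hx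
  set r := Ring.inverse (pivot t g x) with hr
  calc x * (r * g) = (1 - t * g) * (x * (r * g)) + t * (g * x * r * g) := by noncomm_ring
    _ = _ := by rw [this]; noncomm_ring

end IsGeneralizedInverse

end GeneralizedInverse

/-! ### Smoothness of the block chart -/

section NormedChart

variable (𝕜 : Type*) [NontriviallyNormedField 𝕜] {A : Type*} [NormedRing A] [NormedAlgebra 𝕜 A]
  [CompleteSpace A] {t g : A}

lemma isOpen_setOf_isUnit_pivot (t g : A) : IsOpen {x : A | IsUnit (pivot t g x)} := by
  have : Continuous (pivot t g) := by unfold pivot; fun_prop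
  exact Units.isOpen.preimage this

lemma contDiffAt_slope {n : WithTop ℕ∞} {x : A} (hx : IsUnit (pivot t g x)) :
    ContDiffAt 𝕜 n (slope t g) x := by
  have h1 : ContDiffAt 𝕜 n (pivot t g) x := by
    unfold pivot
    fun_prop
  obtain ⟨u, hu⟩ := hx
  have h2 : ContDiffAt 𝕜 n Ring.inverse (pivot t g x) := hu ▸ contDiffAt_ringInverse 𝕜 u
  have h3 : ContDiffAt 𝕜 n (fun x => Ring.inverse (pivot t g x)) x := h2.comp x h1
  unfold slope
  fun_prop

lemma contDiffAt_blockChart {n : WithTop ℕ∞} {x : A} (hx : IsUnit (pivot t g x)) :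
    ContDiffAt 𝕜 n (blockChart t g) x := by
  have := contDiffAt_slope 𝕜 (n := n) hx
  unfold blockChart
  fun_prop

omit [CompleteSpace A] in
lemma contDiff_blockChartSymm {n : WithTop ℕ∞} : ContDiff 𝕜 n (blockChartSymm t g) := by
  unfold blockChartSymm
  fun_prop

/-- The block coordinates as a chart around `t`, with source and target the open set where the pivot
is invertible. -/
def IsGeneralizedInverse.chart (h : IsGeneralizedInverse t g) : OpenPartialHomeomorph A A where
  toFun := blockChart t g
  invFun := blockChartSymm t g
  source := {x | IsUnit (pivot t g x)}
  target := {x | IsUnit (pivot t g x)}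
  map_source' x hx := by simpa [h.pivot_blockChart] using hx
  map_target' y hy := by simpa [h.pivot_blockChartSymm] using hy
  left_inv' x hx := h.blockChartSymm_blockChart hx
  right_inv' y hy := h.blockChart_blockChartSymm hy
  open_source := isOpen_setOf_isUnit_pivot t g
  open_target := isOpen_setOf_isUnit_pivot t g
  continuousOn_toFun x hx := by
    have h1 : ContinuousAt (pivot t g) x := by unfold pivot; fun_prop
    obtain ⟨u, hu⟩ := id hx
    have h2 : ContinuousAt Ring.inverse (pivot t g x) := hu ▸ NormedRing.inverse_continuousAt u
    have h3 : ContinuousAt (fun x => Ring.inverse (pivot t g x)) x := h2.comp h1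
    refine ContinuousAt.continuousWithinAt ?_
    unfold blockChart slope
    fun_prop
  continuousOn_invFun := by
    refine Continuous.continuousOn ?_
    unfold blockChartSymm
    fun_prop

end NormedChart

/-! ### Fredholm operators near a given one -/

section FredholmOperators

variable {H : Type*} [NormedAddCommGroup H] [InnerProductSpace ℂ H]

/-- A generalized inverse of a Fredholm operator can be chosen with a prescribed projection onto the
kernel. -/
lemma exists_isGeneralizedInverse {t P : H →L[ℂ] H} (ht : t.IsFredholm)
    (hP : ∀ v, t (P v) = 0) (hP' : ∀ v, t v = 0 → P v = v) :
    ∃ g : H →L[ℂ] H, IsGeneralizedInverse t g ∧ 1 - g * t = P := by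
  obtain ⟨pkg⟩ := ht.nonempty_fredholmPackage
  have ht' : ∀ v, t v = pkg.equiv (pkg.decDom.proj v) := fun v => by
    conv_lhs => rw [pkg.eq_equiv]
    rfl
  have hproj : ∀ w : pkg.decDom.X₁, pkg.decDom.proj (w : H) = w := fun w => by simp
  have hproj' : ∀ w : pkg.decCodom.X₁, pkg.decCodom.proj (w : H) = w := fun w => by simp
  set g₀ : H →L[ℂ] H := pkg.quasiInverse with hg₀
  have hg : ∀ v, g₀ v = pkg.equiv.symm (pkg.decCodom.proj v) := fun v => rfl
  have h1 : t * g₀ * t = t := by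
    ext v
    change t (g₀ (t v)) = t v
    rw [hg, ht' v, hproj', ContinuousLinearEquiv.symm_apply_apply, ht', hproj]
  have h2 : g₀ * t * g₀ = g₀ := by
    ext v
    change g₀ (t (g₀ v)) = g₀ v
    rw [hg v, ht', hproj, ContinuousLinearEquiv.apply_symm_apply, hg, hproj']
  have h3 : t * P = 0 := by ext v; exact hP v
  have h4 : P * (1 - g₀ * t) = 1 - g₀ * t := by
    ext v
    refine hP' _ ?_
    have : t * (1 - g₀ * t) = 0 := by rw [mul_sub, ← mul_assoc, h1, mul_one, sub_self]
    exact congrArg (fun f : H →L[ℂ] H => f v) this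
  have h5 : t * (1 - P) = t := by rw [mul_sub, h3, mul_one, sub_zero]
  have h6 : 1 - (1 - P) * g₀ * t = P := by
    calc 1 - (1 - P) * g₀ * t = P + (1 - g₀ * t) - P * (1 - g₀ * t) := by noncomm_ring
      _ = P := by rw [h4]; simp
  -- `g₀` has some projection onto the kernel; its values are corrected to lie in the kernel of `P`.
  refine ⟨(1 - P) * g₀, ⟨?_, ?_⟩, h6⟩
  · rw [← mul_assoc, h5, h1]
  · calc (1 - P) * g₀ * t * ((1 - P) * g₀) = (1 - P) * (g₀ * (t * (1 - P)) * g₀) := by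
          noncomm_ring
      _ = _ := by rw [h5, h2]

namespace IsGeneralizedInverse

variable {t g x : H →L[ℂ] H} (h : IsGeneralizedInverse t g)
include h

lemma apply_p (v : H) : t ((1 - g * t) v) = 0 :=
  congrArg (fun f : H →L[ℂ] H => f v) h.t_mul_p

omit h in
lemma p_apply_of_mem_ker {v : H} (hv : t v = 0) : (1 - g * t) v = v := by
  simp [hv]

lemma ker_q : (1 - t * g).ker = t.range := by
  ext v
  constructor
  · intro hv
    have hv' : v - t (g v) = 0 := hv
    exact ⟨g v, (sub_eq_zero.mp hv').symm⟩
  · rintro ⟨w, rfl⟩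
    exact congrArg (fun f : H →L[ℂ] H => f w) h.q_mul_t

lemma finrank_range_q :
    Module.finrank ℂ (1 - t * g).range = Module.finrank ℂ (H ⧸ t.range) := by
  rw [← h.ker_q]
  exact ((1 - t * g : H →L[ℂ] H).toLinearMap.quotKerEquivRange).finrank_eq.symm

lemma finiteDimensional_range_q (ht : t.IsFredholm) :
    FiniteDimensional ℂ (1 - t * g).range := by
  have h1 : FiniteDimensional ℂ (H ⧸ (1 - t * g).ker) := by
    rw [h.ker_q]; exact ht.finite_coker
  exact ((1 - t * g : H →L[ℂ] H).toLinearMap.quotKerEquivRange).finiteDimensional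

/-- Every solution `v` of `x v = c` with `c` in `Im q` is on the graph of the slope, over a vector
`z` of `Ker t` that the Schur complement maps to `c`. -/
lemma apply_eq_iff (hx : IsUnit (pivot t g x)) {c : H} (hc : g c = 0) (v : H) :
    x v = c ↔ ∃ z, t z = 0 ∧ (1 - t * g) (blockChart t g x z) = c ∧ v = z + slope t g x z := by
  have hnf : ∀ z, x (z + slope t g x z)
      = x (g (t z)) + (1 - t * g) (blockChart t g x ((1 - g * t) z)) := fun z => by
    have := congrArg (fun f : H →L[ℂ] H => f z) (h.mul_one_add_slope hx)
    simpa using this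
  constructor
  · intro hv
    set z := v - slope t g x v with hz
    have hvz : v = z + slope t g x z := by
      have : slope t g x (slope t g x v) = 0 :=
        congrArg (fun f : H →L[ℂ] H => f v) (h.slope_mul_slope hx)
      rw [hz, map_sub, this]; simp
    have h1 : (pivot t g x) z = (1 - g * t) z := by
      have : g (x (z + slope t g x z)) = pivot t g x z - (1 - g * t) z :=
        congrArg (fun f : H →L[ℂ] H => f z) (h.g_mul_mul_one_add_slope hx)
      rw [← hvz, hv, hc] at this
      exact (sub_eq_zero.mp this.symm)
    have h2 : z = (1 - g * t) z := by
      have e1 : Ring.inverse (pivot t g x) (pivot t g x z) = z :=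
        congrArg (fun f : H →L[ℂ] H => f z) (Ring.inverse_mul_cancel _ hx)
      have e2 : Ring.inverse (pivot t g x) ((1 - g * t) z) = (1 - g * t) z :=
        congrArg (fun f : H →L[ℂ] H => f z) (h.inverse_mul_p hx)
      rw [← e2, ← h1, e1]
    have h3 : t z = 0 := by rw [h2]; exact h.apply_p z
    refine ⟨z, h3, ?_, hvz⟩
    have := hnf z
    rw [← hvz, hv, h3, map_zero, map_zero, zero_add, ← h2] at this
    exact this.symm
  · rintro ⟨z, hz, hS, rfl⟩
    rw [hnf, hz, p_apply_of_mem_ker hz, hS]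
    simp

/-- The Schur complement of `x` as a linear map from `Ker t` to a complement of `Im t`. -/
def schur (t g x : H →L[ℂ] H) : t.ker →ₗ[ℂ] (1 - t * g).range :=
  (1 - t * g : H →L[ℂ] H).toLinearMap.rangeRestrict ∘ₗ
    (blockChart t g x).toLinearMap ∘ₗ t.ker.subtype

omit h in
lemma schur_eq_zero_iff (z : t.ker) :
    schur t g x z = 0 ↔ (1 - t * g) (blockChart t g x z) = 0 := by
  rw [Subtype.ext_iff]; rfl

/-- The kernel of `x` is the graph of the slope over the kernel of the Schur complement. -/
def kerEquiv (hx : IsUnit (pivot t g x)) : LinearMap.ker (schur t g x) ≃ₗ[ℂ] x.ker := by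
  refine LinearEquiv.ofBijective
    (LinearMap.codRestrict _ ((1 + slope t g x : H →L[ℂ] H).toLinearMap ∘ₗ t.ker.subtype ∘ₗ
      (LinearMap.ker (schur t g x)).subtype) ?_) ⟨?_, ?_⟩
  · rintro ⟨z, hz⟩
    exact (h.apply_eq_iff hx (map_zero g) _).2 ⟨z, z.2, (schur_eq_zero_iff z).1 hz, rfl⟩
  · rw [injective_iff_map_eq_zero]
    rintro ⟨⟨z, hz⟩, hz'⟩ hzero
    have h1 : z + slope t g x z = 0 := congrArg Subtype.val hzero
    have h2 : (1 - g * t) (slope t g x z) = 0 :=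
      congrArg (fun f : H →L[ℂ] H => f z) (h.p_mul_slope hx)
    have h3 : (1 - g * t) (z + slope t g x z) = 0 := by rw [h1, map_zero]
    rw [map_add, h2, add_zero, p_apply_of_mem_ker hz] at h3
    ext
    exact h3
  · rintro ⟨v, hv⟩
    obtain ⟨z, hz, hS, hvz⟩ := (h.apply_eq_iff hx (map_zero g) v).1 hv
    exact ⟨⟨⟨z, hz⟩, (schur_eq_zero_iff ⟨z, hz⟩).2 hS⟩, Subtype.ext hvz.symm⟩

lemma isFredholm_of_isUnit_pivot [FiniteDimensional ℂ t.ker]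
    [FiniteDimensional ℂ (1 - t * g).range] (hx : IsUnit (pivot t g x)) : x.IsFredholm := by
  refine ContinuousLinearMap.IsFredholm.of_isQuasiInverse
    (v := Ring.inverse (pivot t g x) * g) ⟨?_, ?_⟩
  · refine LinearMap.FiniteRangeSetoid.equiv_iff_hasFiniteRange.2 ?_
    have key := h.inverse_mul_g_mul hx
    have : FiniteDimensional ℂ (1 - g * t).range := by
      refine Submodule.finiteDimensional_of_le (S₂ := t.ker) ?_
      rintro _ ⟨v, rfl⟩
      exact h.apply_p v
    have e : (Ring.inverse (pivot t g x) * g : H →L[ℂ] H).toLinearMap ∘ₗ x.toLinearMap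
        - LinearMap.id
        = (-(1 + slope t g x) : H →L[ℂ] H).toLinearMap ∘ₗ (1 - g * t : H →L[ℂ] H).toLinearMap := by
      ext v
      have := congrArg (fun f : H →L[ℂ] H => f v) key
      have this : (Ring.inverse (pivot t g x) * g) (x v)
        = v - (1 + slope t g x) ((1 - g * t) v) := this
      change (Ring.inverse (pivot t g x) * g) (x v) - v = -((1 + slope t g x) ((1 - g * t) v))
      rw [this]; abel
    rw [e]
    exact (LinearMap.hasFiniteRange_iff_range.2 (Submodule.fg_iff_finiteDimensional _ |>.2 this)
      ).comp_left _
  · refine LinearMap.FiniteRangeSetoid.equiv_iff_hasFiniteRange.2 ?_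
    set B := Ring.inverse (pivot t g x) * g
    have e : x.toLinearMap ∘ₗ B.toLinearMap - LinearMap.id
        = (-(1 - t * g) : H →L[ℂ] H).toLinearMap ∘ₗ (1 - x * B : H →L[ℂ] H).toLinearMap := by
      ext v
      have : x (B v) = v - (1 - t * g) ((1 - x * B) v) :=
        congrArg (fun f : H →L[ℂ] H => f v) (h.mul_inverse_mul_g hx)
      change x (B v) - v = -((1 - t * g) ((1 - x * B) v))
      rw [this]; abel
    rw [e]
    refine LinearMap.HasFiniteRange.comp_right (LinearMap.HasFiniteRange.neg ?_) _
    exact LinearMap.hasFiniteRange_iff_range.2 (Submodule.fg_iff_finiteDimensional _ |>.2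
      inferInstance)

/-- Kernel and cokernel of `x` are those of the Schur complement, a linear map between
finite-dimensional spaces that do not depend on `x`; so the index does not depend on `x` either. -/
lemma index_eq_of_isUnit_pivot [FiniteDimensional ℂ t.ker]
    [FiniteDimensional ℂ (1 - t * g).range] (hx : IsUnit (pivot t g x)) :
    index x = (Module.finrank ℂ t.ker : ℤ) - Module.finrank ℂ (1 - t * g).range := by
  have h1 := (schur t g x).finrank_range_add_finrank_ker
  have h2 := (h.kerEquiv hx).finrank_eq
  let f : (1 - t * g).range →ₗ[ℂ] H ⧸ x.range := x.range.mkQ ∘ₗ (1 - t * g).range.subtype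
  have h3 := f.finrank_range_add_finrank_ker
  have hf : LinearMap.range f = ⊤ := by
    rw [LinearMap.range_eq_top]
    intro w
    obtain ⟨v, rfl⟩ := Submodule.mkQ_surjective _ w
    set B := Ring.inverse (pivot t g x) * g
    refine ⟨⟨(1 - t * g) ((1 - x * B) v), ⟨_, rfl⟩⟩, ?_⟩
    have key := congrArg (fun f : H →L[ℂ] H => f v) (h.mul_inverse_mul_g hx)
    have key : x (B v) = v - (1 - t * g) ((1 - x * B) v) := key
    change x.range.mkQ _ = _
    rw [← sub_eq_zero, ← map_sub, Submodule.mkQ_apply, Submodule.Quotient.mk_eq_zero]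
    refine ⟨-(B v), ?_⟩
    change x (-(B v)) = _
    rw [map_neg, key]; abel
  have hker : LinearMap.ker f = LinearMap.range (schur t g x) := by
    ext ⟨c, hc⟩
    have hgc : g c = 0 := by
      obtain ⟨d, rfl⟩ := hc
      exact congrArg (fun f : H →L[ℂ] H => f d) h.g_mul_q
    have hmem : (⟨c, hc⟩ : (1 - t * g).range) ∈ LinearMap.ker f ↔ c ∈ x.range := by
      rw [LinearMap.mem_ker]
      change x.range.mkQ c = 0 ↔ _
      rw [Submodule.mkQ_apply, Submodule.Quotient.mk_eq_zero]
    rw [hmem]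
    constructor
    · rintro ⟨v, hv⟩
      obtain ⟨z, hz, hS, -⟩ := (h.apply_eq_iff hx hgc v).1 hv
      exact ⟨⟨z, hz⟩, Subtype.ext hS⟩
    · rintro ⟨⟨z, hz⟩, hzc⟩
      exact ⟨_, (h.apply_eq_iff hx hgc _).2 ⟨z, hz, congrArg Subtype.val hzc, rfl⟩⟩
  rw [hf, finrank_top, hker] at h3
  unfold index
  omega

end IsGeneralizedInverse

end FredholmOperators

/-! ### Combinatorics of Schubert types -/

namespace SchubertType

/-- The number of entries of `J` that are at least `j`. A subspace `V` has exact type `J` if and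
only if `dim (V ∩ W_j)` is `J.count j` for all `j`. -/
def count (J : SchubertType) (j : ℕ) : ℕ :=
  (Finset.univ.filter fun q : Fin J.length => j ≤ J.entry q).card

variable (J J' : SchubertType)

lemma count_le_length (j : ℕ) : J.count j ≤ J.length :=
  (Finset.card_filter_le _ _).trans (by simp)

lemma le_entry_iff (j : ℕ) (q : Fin J.length) :
    j ≤ J.entry q ↔ J.length - (q : ℕ) ≤ J.count j := by
  constructor
  · intro h
    have : (Finset.Ici q) ⊆ Finset.univ.filter fun q : Fin J.length => j ≤ J.entry q := by
      intro p hp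
      simpa using h.trans (J.strictMono.monotone (Finset.mem_Ici.mp hp))
    simpa [count] using Finset.card_le_card this
  · intro h
    by_contra hlt
    have : (Finset.univ.filter fun q : Fin J.length => j ≤ J.entry q) ⊆ Finset.Ioi q := by
      intro p hp
      rw [Finset.mem_Ioi]
      by_contra hpq
      have h1 : j ≤ J.entry p := by simpa using hp
      exact hlt (h1.trans (J.strictMono.monotone (not_lt.mp hpq)))
    have h2 := Finset.card_le_card this
    rw [Fin.card_Ioi] at h2
    have : J.count j ≤ J.length - 1 - q := h2
    have := q.2
    omega

lemma le_entry_rev_iff (j : ℕ) (i : Fin J.length) :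
    j ≤ J.entry i.rev ↔ (i : ℕ) < J.count j := by
  rw [le_entry_iff, Fin.val_rev]
  have := i.2
  omega

lemma count_zero : J.count 0 = J.length := by simp [count]

lemma count_entry (q : Fin J.length) : J.count (J.entry q) = J.length - q := by
  have : (Finset.univ.filter fun p : Fin J.length => J.entry q ≤ J.entry p) = Finset.Ici q := by
    ext p; simp [J.strictMono.le_iff_le]
  rw [count, this, Fin.card_Ici]

lemma count_entry_succ (q : Fin J.length) :
    J.count (J.entry q + 1) = J.length - q - 1 := by
  have : (Finset.univ.filter fun p : Fin J.length => J.entry q + 1 ≤ J.entry p)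
      = Finset.Ioi q := by
    ext p; simp [J.strictMono.lt_iff_lt]
  rw [count, this, Fin.card_Ioi]; omega

variable {J J'}

lemma ext_of_entry (hl : J.length = J'.length)
    (he : ∀ q : Fin J.length, J.entry q = J'.entry (Fin.cast hl q)) : J = J' := by
  obtain ⟨r, a, ha⟩ := J
  obtain ⟨r', a', ha'⟩ := J'
  obtain rfl : r = r' := hl
  congr
  funext q
  exact he q

lemma ext_of_count (h : ∀ j, J.count j = J'.count j) : J = J' := by
  have hl : J.length = J'.length := by rw [← count_zero, ← count_zero, h]
  refine ext_of_entry hl fun q => ?_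
  apply le_antisymm
  · rw [le_entry_iff, Fin.val_cast, ← hl, ← h, count_entry]
  · rw [le_entry_iff, h, count_entry, Fin.val_cast, ← hl]

lemma le_entry (q : Fin J.length) : (q : ℕ) ≤ J.entry q := by
  obtain ⟨q, hq⟩ := q
  induction q with
  | zero => simp
  | succ n ih =>
    have := ih (by omega)
    have h2 : J.entry ⟨n, by omega⟩ < J.entry ⟨n + 1, hq⟩ :=
      J.strictMono (Fin.mk_lt_mk.2 (Nat.lt_succ_self n))
    simp only at this ⊢
    omega

lemma count_le_count_iff :
    (∀ j, J'.count j ≤ J.count j) ↔ ∃ hl : J'.length ≤ J.length,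
      ∀ i : Fin J'.length, J'.entry i.rev ≤ J.entry (Fin.castLE hl i).rev := by
  constructor
  · intro h
    have hl : J'.length ≤ J.length := by rw [← count_zero, ← count_zero]; exact h 0
    refine ⟨hl, fun i => ?_⟩
    rw [le_entry_rev_iff, Fin.val_castLE]
    exact ((le_entry_rev_iff J' _ i).1 le_rfl).trans_le (h _)
  · rintro ⟨hl, h⟩ j
    by_contra hlt
    push Not at hlt
    have h1 : J.count j < J'.length := hlt.trans_le (J'.count_le_length j)
    have h2 := (le_entry_rev_iff J' j ⟨_, h1⟩).2 hlt
    have h3 := (le_entry_rev_iff J j _).1 (h2.trans (h ⟨_, h1⟩))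
    simp at h3

lemma sum_eq_sum_range (J : SchubertType) :
    ∑ q : Fin J.length, ((J.entry q : ℤ) - ((q : ℕ) : ℤ))
      = ∑ i ∈ Finset.range J.length,
        if h : i < J.length then ((J.entry (Fin.rev ⟨i, h⟩) : ℤ) - (J.length - 1 - i)) else 0 := by
  rw [Finset.sum_range, ← Equiv.sum_comp Fin.revPerm]
  refine Finset.sum_congr rfl fun i _ => ?_
  have := i.2
  rw [dif_pos i.2, Fin.revPerm_apply, Fin.val_rev]
  push_cast [Nat.cast_sub (show (i : ℕ) + 1 ≤ J.length from i.2)]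
  ring

/-- `N_k` is strictly monotone for the order on types given by comparing the dimensions of all
intersections with the flag, as long as the lengths are at least `k`. -/
lemma N_le_N {k : ℕ} (hk : k ≤ J'.length) (h : ∀ j, J'.count j ≤ J.count j) :
    J'.N k ≤ J.N k ∧ (J'.N k = J.N k → J' = J) := by
  obtain ⟨hl, he⟩ := count_le_count_iff.1 h
  have hsum : ∑ q : Fin J'.length, ((J'.entry q : ℤ) - ((q : ℕ) : ℤ))
      ≤ ∑ q : Fin J.length, ((J.entry q : ℤ) - ((q : ℕ) : ℤ))
        + J'.length * (J.length - J'.length) := by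
    rw [sum_eq_sum_range, sum_eq_sum_range]
    set a := fun i => if h : i < J.length then
      ((J.entry (Fin.rev ⟨i, h⟩) : ℤ) - (J.length - 1 - i)) else 0
    have ha : ∀ i, 0 ≤ a i := by
      intro i
      simp only [a]
      split_ifs with hi
      · have := le_entry (Fin.rev (⟨i, hi⟩ : Fin J.length))
        rw [Fin.val_rev] at this
        simp only at this
        omega
      · rfl
    -- Entries are compared from the top; the excess `J.length - J'.length` is the difference of the
    -- positions that are subtracted.
    calc _ ≤ ∑ i ∈ Finset.range J'.length, (a i + (J.length - J'.length : ℤ)) := by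
          refine Finset.sum_le_sum fun i hi => ?_
          have hi := Finset.mem_range.1 hi
          have h1 : J'.entry (Fin.rev ⟨i, hi⟩) ≤ J.entry (Fin.rev ⟨i, hi.trans_le hl⟩) :=
            he ⟨i, hi⟩
          simp only [a]
          rw [dif_pos hi, dif_pos (hi.trans_le hl)]
          omega
      _ = ∑ i ∈ Finset.range J'.length, a i + J'.length * (J.length - J'.length) := by
          rw [Finset.sum_add_distrib, Finset.sum_const, Finset.card_range, nsmul_eq_mul]
      _ ≤ _ := by
          gcongr
          · exact fun _ _ _ => ha _
  have hk' : (k : ℤ) ≤ J'.length := by exact_mod_cast hk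
  have hl' : (J'.length : ℤ) ≤ J.length := by exact_mod_cast hl
  unfold N
  refine ⟨by nlinarith [mul_nonneg (sub_nonneg.2 hl') (sub_nonneg.2 (hk'.trans hl'))],
    fun heq => ?_⟩
  have hprod : ((J.length : ℤ) - J'.length) * (J.length - k) ≤ 0 := by nlinarith
  have hll : J'.length = J.length := by
    by_contra hne
    have h1 : (J'.length : ℤ) < J.length := by
      have : J'.length < J.length := lt_of_le_of_ne hl hne
      exact_mod_cast this
    nlinarith [mul_pos (sub_pos.2 h1) (sub_pos.2 (hk'.trans_lt h1))]
  obtain ⟨r, a, ha⟩ := J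
  obtain ⟨r', a', ha'⟩ := J'
  obtain rfl : r' = r := hll
  have hle : ∀ q, a' q ≤ a q := fun q => by simpa using he q.rev
  have hs : ∑ q : Fin r', ((a' q : ℤ) - ((q : ℕ) : ℤ))
      = ∑ q : Fin r', ((a q : ℤ) - ((q : ℕ) : ℤ)) := by
    simpa using heq
  rw [Finset.sum_eq_sum_iff_of_le (fun q _ => by have := hle q; omega)] at hs
  congr
  funext q
  have := hs q (Finset.mem_univ q)
  omega

variable {k : ℕ} {lam : Fin k → ℕ}

lemma N_ofPartition (hlam : Antitone lam) :
    (ofPartition lam hlam).N k = (∑ i, lam i : ℕ) := by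
  simp only [N, ofPartition, sub_self, mul_zero, zero_add]
  rw [← Equiv.sum_comp Fin.revPerm lam]
  push_cast
  exact Finset.sum_congr rfl fun q _ => by simp

lemma dominates_iff (hlam : Antitone lam) :
    J.Dominates lam ↔ ∀ j, (ofPartition lam hlam).count j ≤ J.count j := by
  rw [count_le_count_iff]
  refine exists_congr fun hl => forall_congr' fun i => ?_
  have e1 : (ofPartition lam hlam).entry i.rev = lam i + (k - 1 - (i : ℕ)) := by
    change lam (Fin.rev (Fin.rev i)) + ((Fin.rev i : Fin k) : ℕ) = _
    rw [Fin.rev_rev, Fin.val_rev]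
    congr 1
    omega
  have e2 : (Fin.castLE hl i).rev = ⟨J.length - 1 - (i : ℕ), by
      have := i.2; have : k ≤ J.length := hl; change (i : ℕ) < k at *; omega⟩ := by
    ext; simp [Fin.val_rev]; omega
  exact Iff.of_eq (congrArg₂ (· ≤ ·) e1.symm (congrArg J.entry e2.symm))

lemma dominates_iff_count (hk : k ≤ J.length) :
    J.Dominates lam ↔ ∀ i : Fin k, (i : ℕ) + 1 ≤ J.count (lam i + (k - 1 - (i : ℕ))) := by
  constructor
  · rintro ⟨h, hd⟩ i
    rw [Nat.succ_le_iff, ← le_entry_rev_iff J _ ⟨i, i.2.trans_le hk⟩]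
    convert hd i using 3
    simp [Fin.val_rev]; omega
  · intro h
    refine ⟨hk, fun i => ?_⟩
    have := (le_entry_rev_iff J _ ⟨i, i.2.trans_le hk⟩).2 (Nat.succ_le_iff.1 (h i))
    convert this using 3
    simp [Fin.val_rev]; omega

end SchubertType

/-! ### Exact types of finite-dimensional subspaces -/

section ExactType

variable {H : Type*} [NormedAddCommGroup H] [InnerProductSpace ℂ H] (W : CompleteFlag H)

lemma hasExactType_iff {V : Submodule ℂ H} {J : SchubertType} :
    HasExactType W V J ↔ FiniteDimensional ℂ V ∧
      ∀ j, Module.finrank ℂ (V ⊓ W.W j : Submodule ℂ H) = J.count j := by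
  constructor
  · intro h
    have := h.finiteDimensional
    refine ⟨this, fun j => ?_⟩
    have hanti : ∀ {a b}, a ≤ b → Module.finrank ℂ (V ⊓ W.W b : Submodule ℂ H)
        ≤ Module.finrank ℂ (V ⊓ W.W a : Submodule ℂ H) := fun hab =>
      Submodule.finrank_mono (inf_le_inf_left V (W.antitone hab))
    have hle := J.count_le_length j
    apply le_antisymm
    · by_cases hc : J.count j = J.length
      · rw [hc, ← h.finrank_eq]
        exact Submodule.finrank_mono inf_le_left
      · -- the last entry below `j`
        have hq : J.length - J.count j - 1 < J.length := by omega
        have h1 : ¬ j ≤ J.entry ⟨_, hq⟩ := by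
          rw [J.le_entry_iff]; simp only; omega
        have h2 := hanti (show J.entry ⟨_, hq⟩ + 1 ≤ j by omega)
        rw [h.finrank_inf_succ] at h2
        simp only at h2
        omega
    · by_cases hc : J.count j = 0
      · rw [hc]; exact Nat.zero_le _
      · have hq : J.length - J.count j < J.length := by omega
        have h1 : j ≤ J.entry ⟨_, hq⟩ := by
          rw [J.le_entry_iff]; simp only; omega
        have h2 := hanti h1
        rw [h.finrank_inf] at h2
        simp only at h2
        omega
  · rintro ⟨hfd, h⟩
    refine ⟨hfd, ?_, fun q => by rw [h, J.count_entry], fun q => by rw [h, J.count_entry_succ]⟩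
    rw [← J.count_zero, ← h 0, W.zero, inf_top_eq]

lemma HasExactType.unique {V : Submodule ℂ H} {J J' : SchubertType}
    (h : HasExactType W V J) (h' : HasExactType W V J') : J = J' :=
  SchubertType.ext_of_count fun j => by
    rw [← ((hasExactType_iff W).1 h).2, ((hasExactType_iff W).1 h').2]

/-- An orthonormal sequence `e` with `W_j = {e_0, …, e_{j-1}}ᗮ`. -/
structure IsAdaptedSequence (e : ℕ → H) : Prop where
  orthonormal : Orthonormal ℂ e
  mem_iff : ∀ j x, x ∈ W.W j ↔ ∀ i < j, inner ℂ (e i) x = 0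

lemma finiteDimensional_quotient (j : ℕ) : FiniteDimensional ℂ (H ⧸ W.W j) := by
  have := W.codim j
  exact Module.rank_lt_aleph0_iff.1 (this ▸ Cardinal.natCast_lt_aleph0)

lemma finrank_quotient (j : ℕ) : Module.finrank ℂ (H ⧸ W.W j) = j :=
  Module.finrank_eq_of_rank_eq (W.codim j)

/-- Take for `e_j` a unit vector of `W_j` that is orthogonal to `W_{j+1}`. -/
lemma exists_isAdaptedSequence [CompleteSpace H] : ∃ e, IsAdaptedSequence W e := by
  have key : ∀ j, ∃ v ∈ W.W j, ‖v‖ = 1 ∧ ∀ x ∈ W.W (j + 1), inner ℂ v x = 0 := by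
    intro j
    have : CompleteSpace (W.W (j + 1)) := (W.isClosed (j + 1)).completeSpace_coe
    have hsup := Submodule.sup_orthogonal_inf_of_hasOrthogonalProjection
      (W.antitone (Nat.le_succ j))
    have hne : (W.W (j + 1))ᗮ ⊓ W.W j ≠ ⊥ := by
      intro hbot
      rw [Nat.succ_eq_add_one, hbot, sup_bot_eq] at hsup
      have h1 := finrank_quotient W (j + 1)
      rw [hsup, finrank_quotient W j] at h1
      omega
    obtain ⟨v, hv, hv0⟩ := Submodule.exists_mem_ne_zero_of_ne_bot hne
    refine ⟨((‖v‖⁻¹ : ℝ) : ℂ) • v, Submodule.smul_mem _ _ hv.2, ?_, fun x hx => ?_⟩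
    · rw [norm_smul, Complex.norm_real, norm_inv, norm_norm,
        inv_mul_cancel₀ (norm_ne_zero_iff.2 hv0)]
    · rw [inner_smul_left, (Submodule.mem_orthogonal' _ _).1 hv.1 x hx, mul_zero]
  choose e he hnorm horth using key
  have hlt : ∀ {i j}, i < j → inner ℂ (e i) (e j) = 0 := fun hij =>
    horth _ _ (W.antitone hij (he _))
  have hon : Orthonormal ℂ e := by
    refine ⟨hnorm, fun i j hij => ?_⟩
    rcases lt_or_gt_of_ne hij with h | h
    · exact hlt h
    · exact inner_eq_zero_symm.1 (hlt h)
  refine ⟨e, hon, fun j x => ⟨fun hx i hi => horth i x (W.antitone hi hx), fun hx => ?_⟩⟩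
  -- `W_j` lies in the orthogonal complement of `e_0, …, e_{j-1}`, and both have codimension `j`.
  let f : H →ₗ[ℂ] (Fin j → ℂ) := LinearMap.pi fun i => (innerSL ℂ (e i)).toLinearMap
  have hWf : W.W j ≤ LinearMap.ker f := by
    intro y hy
    rw [LinearMap.mem_ker]
    funext i
    exact horth i y (W.antitone i.2 hy)
  have hsurj : Function.Surjective ((W.W j).liftQ f hWf) := by
    intro c
    refine ⟨Submodule.Quotient.mk (∑ i, c i • e i), ?_⟩
    rw [Submodule.liftQ_apply]
    funext i
    change inner ℂ (e i) (∑ i, c i • e i) = c i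
    exact (hon.comp _ Fin.val_injective).inner_right_fintype c i
  have := finiteDimensional_quotient W j
  have hinj := (LinearMap.injective_iff_surjective_of_finrank_eq_finrank
    (by rw [finrank_quotient]; simp)).2 hsurj
  rw [← Submodule.Quotient.mk_eq_zero]
  apply hinj
  rw [Submodule.liftQ_apply, map_zero]
  funext i
  exact hx i i.2

lemma exists_inf_eq_bot (V : Submodule ℂ H) [FiniteDimensional ℂ V] : ∃ n, V ⊓ W.W n = ⊥ := by
  let d : ℕ → ℕ := fun n => Module.finrank ℂ (V ⊓ W.W n : Submodule ℂ H)
  obtain ⟨n, hn⟩ : ∃ n, ∀ m, d n ≤ d m :=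
    ⟨Function.argmin d, fun m => Function.argmin_le d m⟩
  refine ⟨n, ?_⟩
  rw [eq_bot_iff, ← W.iInf_eq_bot, le_iInf_iff]
  intro m
  have h1 : V ⊓ W.W (max n m) ≤ V ⊓ W.W n := inf_le_inf_left V (W.antitone (le_max_left _ _))
  rw [← Submodule.eq_of_le_of_finrank_le h1 (hn _)]
  exact inf_le_right.trans (W.antitone (le_max_right _ _))

variable {W}

namespace IsAdaptedSequence

variable {e : ℕ → H} (he : IsAdaptedSequence W e)
include he

lemma mem_succ_iff (j : ℕ) (x : H) :
    x ∈ W.W (j + 1) ↔ x ∈ W.W j ∧ inner ℂ (e j) x = 0 := by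
  rw [he.mem_iff, he.mem_iff]
  constructor
  · exact fun h => ⟨fun i hi => h i (hi.trans (Nat.lt_succ_self j)), h j (Nat.lt_succ_self j)⟩
  · rintro ⟨h1, h2⟩ i hi
    rcases Nat.lt_succ_iff_lt_or_eq.1 hi with h | rfl
    · exact h1 i h
    · exact h2

lemma finrank_inf_le (V : Submodule ℂ H) [FiniteDimensional ℂ V] (j : ℕ) :
    Module.finrank ℂ (V ⊓ W.W j : Submodule ℂ H)
      ≤ Module.finrank ℂ (V ⊓ W.W (j + 1) : Submodule ℂ H) + 1 := by
  let f : (V ⊓ W.W j : Submodule ℂ H) →ₗ[ℂ] ℂ :=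
    (innerSL ℂ (e j)).toLinearMap ∘ₗ (V ⊓ W.W j).subtype
  have h1 := f.finrank_range_add_finrank_ker
  have h2 : Module.finrank ℂ (LinearMap.range f) ≤ 1 :=
    (Submodule.finrank_le _).trans (by simp)
  have h3 : (LinearMap.ker f).map (V ⊓ W.W j).subtype = V ⊓ W.W (j + 1) := by
    ext x
    constructor
    · rintro ⟨y, hy, rfl⟩
      exact ⟨y.2.1, (he.mem_succ_iff j _).2 ⟨y.2.2, hy⟩⟩
    · rintro ⟨hx, hx'⟩
      obtain ⟨h4, h5⟩ := (he.mem_succ_iff j x).1 hx'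
      exact ⟨⟨x, hx, h4⟩, h5, rfl⟩
  have h4 := Submodule.finrank_map_subtype_eq (V ⊓ W.W j) (LinearMap.ker f)
  rw [h3] at h4
  omega

/-- The type of `V` consists of the `j` at which `dim (V ∩ W_j)` drops. -/
lemma exists_hasExactType (V : Submodule ℂ H) [FiniteDimensional ℂ V] :
    ∃ J, HasExactType W V J := by
  set d : ℕ → ℕ := fun n => Module.finrank ℂ (V ⊓ W.W n : Submodule ℂ H) with hd
  obtain ⟨n, hn⟩ := exists_inf_eq_bot W V
  have hanti : Antitone d := fun a b hab =>
    Submodule.finrank_mono (inf_le_inf_left V (W.antitone hab))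
  have hdn : ∀ m, n ≤ m → d m = 0 := fun m hm => by
    have h0 : d n = 0 := by simp only [hd]; rw [hn, finrank_bot]
    exact Nat.le_zero.1 (h0 ▸ hanti hm)
  have hstep : ∀ j, d j ≤ d (j + 1) + 1 := he.finrank_inf_le V
  set D := (Finset.range n).filter fun j => d (j + 1) < d j with hD
  let J : SchubertType := ⟨D.card, D.orderEmbOfFin rfl, (D.orderEmbOfFin rfl).strictMono⟩
  have hcount : ∀ j, J.count j = (D.filter (j ≤ ·)).card := by
    intro j
    have : D.filter (j ≤ ·) = (Finset.univ.filter fun q : Fin J.length => j ≤ J.entry q).map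
        (D.orderEmbOfFin rfl).toEmbedding := by
      ext i
      simp only [Finset.mem_filter, Finset.mem_map, Finset.mem_univ, true_and]
      constructor
      · rintro ⟨h1, h2⟩
        have h3 : i ∈ Set.range (D.orderEmbOfFin rfl) := by
          rw [Finset.range_orderEmbOfFin]; exact h1
        obtain ⟨q, rfl⟩ := h3
        exact ⟨q, h2, rfl⟩
      · rintro ⟨q, h1, rfl⟩
        exact ⟨Finset.orderEmbOfFin_mem D rfl q, h1⟩
    rw [this, Finset.card_map]
    rfl
  refine ⟨J, (hasExactType_iff W).2 ⟨inferInstance, fun j => ?_⟩⟩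
  rw [hcount]
  change d j = _
  have hlarge : ∀ m, n ≤ m → d m = (D.filter (m ≤ ·)).card := by
    intro m hm
    rw [hdn m hm, eq_comm, Finset.card_eq_zero, Finset.filter_eq_empty_iff]
    intro i hi
    have := (Finset.mem_range.1 (Finset.mem_filter.1 hi).1)
    omega
  rcases le_total n j with hj | hj
  · exact hlarge j hj
  · induction hj using Nat.decreasingInduction with
    | self => exact hlarge n le_rfl
    | of_succ j hj ih =>
      have hs := hstep j
      have ha := hanti (Nat.le_succ j)
      by_cases hlt : d (j + 1) < d j
      · have : D.filter (j ≤ ·) = insert j (D.filter (j + 1 ≤ ·)) := by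
          ext i
          simp only [Finset.mem_filter, Finset.mem_insert]
          constructor
          · rintro ⟨h1, h2⟩
            rcases eq_or_lt_of_le h2 with rfl | h
            · exact Or.inl rfl
            · exact Or.inr ⟨h1, h⟩
          · rintro (rfl | ⟨h1, h2⟩)
            · exact ⟨Finset.mem_filter.2 ⟨Finset.mem_range.2 hj, hlt⟩, le_rfl⟩
            · exact ⟨h1, by omega⟩
        rw [this, Finset.card_insert_of_notMem (by simp), ← ih]
        omega
      · have : D.filter (j ≤ ·) = D.filter (j + 1 ≤ ·) := by
          refine Finset.filter_congr fun i hi => ?_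
          have : d (i + 1) < d i := (Finset.mem_filter.1 hi).2
          constructor
          · intro h
            rcases eq_or_lt_of_le h with rfl | h
            · exact absurd this hlt
            · exact h
          · intro h; omega
        rw [this, ← ih]
        simp only [Nat.succ_eq_add_one] at ha
        omega

variable {V : Submodule ℂ H} {J : SchubertType}

/-- The functionals `⟪e_j, ·⟫`, for `j` an entry of the type of `V`, are coordinates on `V`. -/
lemma eq_zero_of_inner_entry (h : HasExactType W V J) {x : H} (hx : x ∈ V)
    (hx0 : ∀ p, inner ℂ (e (J.entry p)) x = 0) : x = 0 := by
  obtain ⟨hfd, hcount⟩ := (hasExactType_iff W).1 h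
  have hmem : ∀ j, x ∈ W.W j := by
    intro j
    induction j with
    | zero => rw [W.zero]; trivial
    | succ j ih =>
      by_cases hj : ∃ p, J.entry p = j
      · obtain ⟨p, rfl⟩ := hj
        exact (he.mem_succ_iff _ x).2 ⟨ih, hx0 p⟩
      · have hc : J.count j = J.count (j + 1) := by
          unfold SchubertType.count
          congr 1
          refine Finset.filter_congr fun q _ => ?_
          have : J.entry q ≠ j := fun h => hj ⟨q, h⟩
          omega
        have h1 : V ⊓ W.W (j + 1) ≤ V ⊓ W.W j := inf_le_inf_left V (W.antitone (Nat.le_succ j))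
        have h2 := Submodule.eq_of_le_of_finrank_le h1 (by rw [hcount, hcount, hc])
        exact (h2.symm ▸ (⟨hx, ih⟩ : x ∈ V ⊓ W.W j) : x ∈ V ⊓ W.W (j + 1)).2
  have : x ∈ ⨅ j, W.W j := Submodule.mem_iInf _ |>.2 hmem
  rw [W.iInf_eq_bot] at this
  exact this

lemma exists_echelon (h : HasExactType W V J) (q : Fin J.length) :
    ∃ f ∈ V ⊓ W.W (J.entry q), ∀ p, inner ℂ (e (J.entry p)) f = if p = q then 1 else 0 := by
  have hfd := h.finiteDimensional
  let ψ : (V ⊓ W.W (J.entry q) : Submodule ℂ H) →ₗ[ℂ] ({p // q ≤ p} → ℂ) :=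
    LinearMap.pi fun p => (innerSL ℂ (e (J.entry p))).toLinearMap ∘ₗ (V ⊓ W.W _).subtype
  have hlow : ∀ x ∈ W.W (J.entry q), ∀ p < q, inner ℂ (e (J.entry p)) x = 0 := fun x hx p hp =>
    (he.mem_iff _ x).1 hx _ (J.strictMono hp)
  have hinj : Function.Injective ψ := by
    rw [injective_iff_map_eq_zero]
    rintro ⟨x, hx⟩ hx0
    ext
    refine he.eq_zero_of_inner_entry h hx.1 fun p => ?_
    rcases lt_or_ge p q with hp | hp
    · exact hlow x hx.2 p hp
    · exact congrFun hx0 ⟨p, hp⟩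
  have hsurj := (LinearMap.injective_iff_surjective_of_finrank_eq_finrank (by
    rw [h.finrank_inf, Module.finrank_fintype_fun_eq_card, Fintype.card_subtype,
      show (Finset.univ.filter fun p => q ≤ p) = Finset.Ici q by ext; simp, Fin.card_Ici])).1 hinj
  obtain ⟨⟨f, hf⟩, hψ⟩ := hsurj fun p => if p.1 = q then 1 else 0
  refine ⟨f, hf, fun p => ?_⟩
  rcases lt_or_ge p q with hp | hp
  · rw [if_neg hp.ne]; exact hlow f hf.2 p hp
  · exact congrFun hψ ⟨p, hp⟩

omit he in
lemma le_finrank_inf [FiniteDimensional ℂ V] {f : Fin J.length → H}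
    (hfV : ∀ q, f q ∈ V) (hfW : ∀ q, f q ∈ W.W (J.entry q))
    (hf : ∀ p q, inner ℂ (e (J.entry p)) (f q) = if p = q then 1 else 0) (q : Fin J.length) :
    J.length - q ≤ Module.finrank ℂ (V ⊓ W.W (J.entry q) : Submodule ℂ H) := by
  let b : {p // q ≤ p} → (V ⊓ W.W (J.entry q) : Submodule ℂ H) := fun p =>
    ⟨f p, hfV p, W.antitone (J.strictMono.monotone p.2) (hfW p)⟩
  have hb : LinearIndependent ℂ b := by
    rw [Fintype.linearIndependent_iff]
    intro c hc p
    have h1 : ∑ i, c i • f i = 0 := by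
      have := congrArg Subtype.val hc
      simpa [b] using this
    have h2 := congrArg (inner ℂ (e (J.entry p))) h1
    rw [inner_sum, inner_zero_right] at h2
    simpa [inner_smul_right, hf, ← Subtype.ext_iff] using h2
  have := hb.fintype_card_le_finrank
  rwa [Fintype.card_subtype,
      show (Finset.univ.filter fun p => q ≤ p) = Finset.Ici q by ext; simp, Fin.card_Ici] at this

end IsAdaptedSequence

/-- If the dimensions of the intersections are at most those of the type `J`, it suffices to bound
them below at the entries of `J`. -/
lemma HasExactType.of_finrank_inf {V : Submodule ℂ H} {J : SchubertType} [FiniteDimensional ℂ V]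
    (hle : ∀ j, Module.finrank ℂ (V ⊓ W.W j : Submodule ℂ H) ≤ J.count j)
    (hge : ∀ q : Fin J.length,
      J.length - q ≤ Module.finrank ℂ (V ⊓ W.W (J.entry q) : Submodule ℂ H)) :
    HasExactType W V J := by
  refine (hasExactType_iff W).2 ⟨inferInstance, fun j => le_antisymm (hle j) ?_⟩
  by_cases hc : J.count j = 0
  · rw [hc]; exact Nat.zero_le _
  · have hl := J.count_le_length j
    have hq : J.length - J.count j < J.length := by omega
    have h1 : j ≤ J.entry ⟨_, hq⟩ := by
      rw [J.le_entry_iff]; simp only; omega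
    have h2 := hge ⟨_, hq⟩
    have h3 : Module.finrank ℂ (V ⊓ W.W (J.entry ⟨_, hq⟩) : Submodule ℂ H)
        ≤ Module.finrank ℂ (V ⊓ W.W j : Submodule ℂ H) :=
      Submodule.finrank_mono (inf_le_inf_left V (W.antitone h1))
    simp only at h2
    omega

end ExactType

/-! ### Semicontinuity of the intersections of the kernel with the flag -/

section Semicontinuity

variable {H : Type*} [NormedAddCommGroup H] [InnerProductSpace ℂ H] [CompleteSpace H]

omit [CompleteSpace H] in
lemma exists_isGeneralizedInverse_of_isFredholm {t : H →L[ℂ] H} (ht : t.IsFredholm) :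
    ∃ g : H →L[ℂ] H, IsGeneralizedInverse t g := by
  obtain ⟨Q, hQ⟩ := ht.closedComplemented_ker
  obtain ⟨g, hg, -⟩ := exists_isGeneralizedInverse (P := t.ker.subtypeL ∘L Q) ht
    (fun v => (Q v).2) (fun v hv => congrArg Subtype.val (hQ ⟨v, hv⟩))
  exact ⟨g, hg⟩

omit [CompleteSpace H] in
lemma Fred.length_eq {t : H →L[ℂ] H} {p : ℤ} (ht : t ∈ Fred H p) :
    (Module.finrank ℂ t.ker : ℤ) = p + Module.finrank ℂ (H ⧸ t.range) := by
  have := ht.2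
  unfold index at this
  omega

omit [CompleteSpace H] in
lemma IsGeneralizedInverse.mem_Fred {t g x : H →L[ℂ] H} {p : ℤ} (h : IsGeneralizedInverse t g)
    (ht : t ∈ Fred H p) (hx : IsUnit (pivot t g x)) : x ∈ Fred H p := by
  have := ht.1.finite_ker
  have := h.finiteDimensional_range_q ht.1
  refine ⟨h.isFredholm_of_isUnit_pivot hx, ?_⟩
  rw [h.index_eq_of_isUnit_pivot hx, h.finrank_range_q, ← ht.2, index]

lemma IsGeneralizedInverse.eventually_isUnit {t g : H →L[ℂ] H} (h : IsGeneralizedInverse t g) :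
    ∀ᶠ x in 𝓝 t, IsUnit (pivot t g x) :=
  (isOpen_setOf_isUnit_pivot t g).mem_nhds (by simp [pivot_self h])

lemma isOpen_Fred (p : ℤ) : IsOpen (Fred H p) := by
  rw [isOpen_iff_mem_nhds]
  intro t ht
  obtain ⟨g, hg⟩ := exists_isGeneralizedInverse_of_isFredholm ht.1
  filter_upwards [hg.eventually_isUnit] with x hx using hg.mem_Fred ht hx

variable {W : CompleteFlag H} {e : ℕ → H}

lemma IsAdaptedSequence.eventually_finrank_inf_le (he : IsAdaptedSequence W e) {t : H →L[ℂ] H}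
    (ht : t.IsFredholm) (j : ℕ) :
    ∀ᶠ x : H →L[ℂ] H in 𝓝 t, Module.finrank ℂ (x.ker ⊓ W.W j : Submodule ℂ H)
      ≤ Module.finrank ℂ (t.ker ⊓ W.W j : Submodule ℂ H) := by
  obtain ⟨g, hg⟩ := exists_isGeneralizedInverse_of_isFredholm ht
  have hfd := ht.finite_ker
  -- `Ker x ∩ W_j` embeds into the kernel of `A x`, a map on the fixed space `Ker t` that depends
  -- continuously on `x` and so has locally non-decreasing rank.
  let Λ : H →L[ℂ] (Fin j → ℂ) := ContinuousLinearMap.pi fun i => innerSL ℂ (e i)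
  have hΛ : ∀ v, Λ v = 0 ↔ v ∈ W.W j := by
    intro v
    rw [he.mem_iff]
    constructor
    · exact fun h i hi => congrFun h ⟨i, hi⟩
    · exact fun h => funext fun i => h i i.2
  let A : (H →L[ℂ] H) → (t.ker →L[ℂ] (Fin j → ℂ)) := fun x =>
    Λ ∘L (1 + slope t g x) ∘L t.ker.subtypeL
  have hA : ContinuousAt A t := by
    have h1 : ContinuousAt (slope t g) t :=
      (contDiffAt_slope ℂ (n := 0) (by rw [pivot_self hg]; exact isUnit_one)).continuousAt
    simp only [A]
    fun_prop
  have hrn : ∀ x, Module.finrank ℂ (LinearMap.range (A x).toLinearMap)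
      + Module.finrank ℂ (LinearMap.ker (A x).toLinearMap) = Module.finrank ℂ t.ker := fun x =>
    (A x).toLinearMap.finrank_range_add_finrank_ker
  have hrank : ∀ᶠ x in 𝓝 t, Module.finrank ℂ (LinearMap.range (A t).toLinearMap)
      ≤ Module.finrank ℂ (LinearMap.range (A x).toLinearMap) := by
    have h1 := hA.eventually ((isOpen_setOfPred_nat_le_rank (𝕜 := ℂ) (E := t.ker)
      (F := Fin j → ℂ) (Module.finrank ℂ (LinearMap.range (A t).toLinearMap))).mem_nhds
        (by
          rw [Set.mem_ofPred_eq, LinearMap.rank, Module.finrank_eq_rank]))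
    filter_upwards [h1] with x hx
    rw [LinearMap.rank, ← Module.finrank_eq_rank] at hx
    exact_mod_cast hx
  have hkert : Module.finrank ℂ (LinearMap.ker (A t).toLinearMap)
      = Module.finrank ℂ (t.ker ⊓ W.W j : Submodule ℂ H) := by
    have h0 : slope t g t = 0 := by
      rw [slope, mul_assoc, hg.t_mul_p, mul_zero, neg_zero]
    rw [← Submodule.finrank_map_subtype_eq t.ker]
    have : ∀ z : t.ker, A t z = Λ z := fun z => by simp [A, h0]
    have h2 : ((LinearMap.ker (A t).toLinearMap).map t.ker.subtype) = t.ker ⊓ W.W j := by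
      ext v
      constructor
      · rintro ⟨z, hz, rfl⟩
        exact ⟨z.2, (hΛ _).1 ((this z).symm.trans hz)⟩
      · rintro ⟨hv, hv'⟩
        exact ⟨⟨v, hv⟩, (this ⟨v, hv⟩).trans ((hΛ v).2 hv'), rfl⟩
    rw [h2]
  filter_upwards [hrank, hg.eventually_isUnit] with x hx hxu
  have hkerx : Module.finrank ℂ (x.ker ⊓ W.W j : Submodule ℂ H)
      ≤ Module.finrank ℂ (LinearMap.ker (A x).toLinearMap) := by
    have hsub : x.ker ⊓ W.W j ≤ (LinearMap.ker (A x).toLinearMap).map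
        ((1 + slope t g x : H →L[ℂ] H).toLinearMap ∘ₗ t.ker.subtype) := by
      rintro v ⟨hv, hv'⟩
      obtain ⟨z, hz, -, rfl⟩ := (hg.apply_eq_iff hxu (map_zero g) v).1 hv
      exact ⟨⟨z, hz⟩, (hΛ _).2 hv', rfl⟩
    exact (Submodule.finrank_mono hsub).trans (Submodule.finrank_map_le _ _)
  have h1 := hrn x
  have h2 := hrn t
  omega

lemma IsAdaptedSequence.eventually_forall_finrank_inf_le (he : IsAdaptedSequence W e)
    {t : H →L[ℂ] H} (ht : t.IsFredholm) :
    ∀ᶠ x : H →L[ℂ] H in 𝓝 t, ∀ j, Module.finrank ℂ (x.ker ⊓ W.W j : Submodule ℂ H)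
      ≤ Module.finrank ℂ (t.ker ⊓ W.W j : Submodule ℂ H) := by
  have hfd := ht.finite_ker
  obtain ⟨n, hn⟩ := exists_inf_eq_bot W t.ker
  -- Beyond `n` both sides vanish near `t`, so that finitely many conditions remain.
  have h1 : ∀ᶠ x : H →L[ℂ] H in 𝓝 t, ∀ j ∈ Finset.range (n + 1),
      Module.finrank ℂ (x.ker ⊓ W.W j : Submodule ℂ H)
        ≤ Module.finrank ℂ (t.ker ⊓ W.W j : Submodule ℂ H) :=
    (Filter.eventually_all_finset _).2 fun j _ => he.eventually_finrank_inf_le ht j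
  filter_upwards [h1, (isOpen_Fred (index t)).mem_nhds ⟨ht, rfl⟩] with x hx hxF j
  have := hxF.1.finite_ker
  by_cases hj : j ≤ n
  · exact hx j (Finset.mem_range.2 (by omega))
  · have h2 := hx n (Finset.mem_range.2 (by omega))
    rw [hn, finrank_bot] at h2
    exact (Submodule.finrank_mono (inf_le_inf_left x.ker (W.antitone (by omega : n ≤ j)))).trans
      (h2.trans (Nat.zero_le _))

end Semicontinuity

/-! ### Tangent and normal spaces in an adapted chart -/

section Tangent

variable {E : Type*} [NormedAddCommGroup E] [NormedSpace ℝ E]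
  {X S : Set E} {φ : OpenPartialHomeomorph E E} {F : Submodule ℝ E}

namespace IsAdaptedChart

variable (h : IsAdaptedChart X S φ F)
include h

lemma differentiableAt {q : E} (hq : q ∈ φ.source) : DifferentiableAt ℝ φ q :=
  (h.contDiffOn.contDiffAt (φ.open_source.mem_nhds hq)).differentiableAt (by simp)

lemma differentiableAt_symm {q : E} (hq : q ∈ φ.target) : DifferentiableAt ℝ φ.symm q :=
  (h.contDiffOn_symm.contDiffAt (φ.open_target.mem_nhds hq)).differentiableAt (by simp)

lemma fderiv_symm_fderiv {q : E} (hq : q ∈ φ.source) (v : E) :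
    fderiv ℝ φ.symm (φ q) (fderiv ℝ φ q v) = v := by
  have h1 : HasFDerivAt (φ.symm ∘ φ) ((fderiv ℝ φ.symm (φ q)) ∘L (fderiv ℝ φ q)) q :=
    (h.differentiableAt_symm (φ.map_source hq)).hasFDerivAt.comp q
      (h.differentiableAt hq).hasFDerivAt
  have h2 : HasFDerivAt (φ.symm ∘ φ) (ContinuousLinearMap.id ℝ E) q :=
    (hasFDerivAt_id q).congr_of_eventuallyEq (φ.eventually_left_inverse hq)
  exact congrArg (fun f : E →L[ℝ] E => f v) (h1.unique h2)

lemma fderiv_fderiv_symm {q : E} (hq : q ∈ φ.source) (v : E) :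
    fderiv ℝ φ q (fderiv ℝ φ.symm (φ q) v) = v := by
  have hq' := φ.map_source hq
  have h0 := (h.differentiableAt hq).hasFDerivAt
  have h1 : HasFDerivAt (φ ∘ φ.symm) ((fderiv ℝ φ q) ∘L (fderiv ℝ φ.symm (φ q))) (φ q) := by
    refine HasFDerivAt.comp (φ q) ?_ (h.differentiableAt_symm hq').hasFDerivAt
    rwa [φ.left_inv hq]
  have h2 : HasFDerivAt (φ ∘ φ.symm) (ContinuousLinearMap.id ℝ E) (φ q) :=
    (hasFDerivAt_id _).congr_of_eventuallyEq (φ.eventually_right_inverse hq')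
  exact congrArg (fun f : E →L[ℝ] E => f v) (h1.unique h2)

lemma fderiv_surjective {q : E} (hq : q ∈ φ.source) : Function.Surjective (fderiv ℝ φ q) :=
  fun v => ⟨_, h.fderiv_fderiv_symm hq v⟩

lemma tangentSubspace_eq {q : E} (hq : q ∈ φ.source) (hqS : q ∈ S) :
    tangentSubspace S q = F.comap (fderiv ℝ φ q).toLinearMap := by
  apply le_antisymm
  · refine Submodule.span_le.2 ?_
    rintro v ⟨γ, hγ0, hγS, hγ⟩
    have h1 : HasDerivAt (φ ∘ γ) (fderiv ℝ φ q v) 0 := by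
      refine HasFDerivAt.comp_hasDerivAt (0 : ℝ) ?_ hγ
      rw [hγ0]
      exact (h.differentiableAt hq).hasFDerivAt
    have hsrc : ∀ᶠ t in 𝓝 (0 : ℝ), γ t ∈ φ.source :=
      hγ.continuousAt.eventually (φ.open_source.mem_nhds (hγ0.symm ▸ hq))
    have h2 := (hasDerivAt_iff_tendsto_slope.1 h1)
    refine h.isClosed.mem_of_tendsto h2 ?_
    refine (Filter.Eventually.filter_mono nhdsWithin_le_nhds ?_)
    filter_upwards [hsrc, hγS] with t ht htS
    have h3 : φ (γ t) ∈ F := (h.mem_iff _ ht).1 htS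
    have h4 : φ (γ 0) ∈ F := by rw [hγ0]; exact (h.mem_iff _ hq).1 hqS
    rw [slope_def_module]
    exact F.smul_mem _ (F.sub_mem h3 h4)
  · intro v hv
    refine Submodule.subset_span ⟨fun t => φ.symm (φ q + t • fderiv ℝ φ q v), ?_, ?_, ?_⟩
    · simp [φ.left_inv hq]
    · have hc : ContinuousAt (fun t : ℝ => φ q + t • fderiv ℝ φ q v) 0 := by fun_prop
      have : ∀ᶠ t : ℝ in 𝓝 0, φ q + t • fderiv ℝ φ q v ∈ φ.target :=
        hc.eventually (φ.open_target.mem_nhds (by simpa using φ.map_source hq))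
      filter_upwards [this] with t ht
      rw [h.mem_iff _ (φ.map_target ht), φ.right_inv ht]
      exact F.add_mem ((h.mem_iff _ hq).1 hqS) (F.smul_mem _ hv)
    · have h1 : HasDerivAt (fun t : ℝ => φ q + t • fderiv ℝ φ q v) (fderiv ℝ φ q v) 0 := by
        simpa using ((hasDerivAt_id (0 : ℝ)).smul_const (fderiv ℝ φ q v)).const_add (φ q)
      have h2 : HasFDerivAt φ.symm (fderiv ℝ φ.symm (φ q)) (φ q + (0 : ℝ) • fderiv ℝ φ q v) := by
        simpa using (h.differentiableAt_symm (φ.map_source hq)).hasFDerivAt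
      have h3 := h2.comp_hasDerivAt (0 : ℝ) h1
      rwa [h.fderiv_symm_fderiv hq] at h3

/-- The trivialization of the normal bundle that the derivatives of an adapted chart induce. -/
def normalEquiv {q : E} (hq : q ∈ φ.source) (hqS : q ∈ S) : NormalSpace S q ≃ₗ[ℝ] (E ⧸ F) :=
  Submodule.Quotient.equiv _ F
    (LinearEquiv.ofBijective (fderiv ℝ φ q).toLinearMap
      ⟨Function.LeftInverse.injective (h.fderiv_symm_fderiv hq), h.fderiv_surjective hq⟩) (by
    rw [h.tangentSubspace_eq hq hqS]
    exact Submodule.map_comap_eq_of_surjective (h.fderiv_surjective hq) F)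

lemma normalEquiv_mk {q : E} (hq : q ∈ φ.source) (hqS : q ∈ S) (v : E) :
    h.normalEquiv hq hqS (Submodule.Quotient.mk v) = Submodule.Quotient.mk (fderiv ℝ φ q v) :=
  rfl

end IsAdaptedChart

end Tangent

/-! ### The canonical orientation of a complex quotient -/

section ComplexOrientation

variable {E : Type*} [NormedAddCommGroup E] [NormedSpace ℝ E] [NormedSpace ℂ E]
  [IsScalarTower ℝ ℂ E]

/-- The orientation given by `v₀, i v₀, v₁, i v₁, …` does not depend on the complex basis `v`,
because the real determinant of a complex automorphism is the squared modulus of its complex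
determinant. -/
lemma orientation_eq_of_complex {M : Type*} [AddCommGroup M] [Module ℂ M] [Module ℝ M]
    [IsScalarTower ℝ ℂ M] {n : ℕ} (v v' : Fin n → M)
    (b b' : Module.Basis (Fin (2 * n)) ℝ M)
    (hb : ∀ i : Fin n, b ⟨2 * (i : ℕ), by omega⟩ = v i ∧
      b ⟨2 * (i : ℕ) + 1, by omega⟩ = Complex.I • v i)
    (hb' : ∀ i : Fin n, b' ⟨2 * (i : ℕ), by omega⟩ = v' i ∧
      b' ⟨2 * (i : ℕ) + 1, by omega⟩ = Complex.I • v' i) :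
    b.orientation = b'.orientation := by
  have hfin : FiniteDimensional ℝ M := b.finiteDimensional_of_finite
  have hfinC : FiniteDimensional ℂ M := Module.Finite.right ℝ ℂ M
  have hrank : Module.finrank ℂ M = n := by
    have h1 := Module.finrank_mul_finrank ℝ ℂ M
    rw [Complex.finrank_real_complex, Module.finrank_eq_card_basis b, Fintype.card_fin] at h1
    omega
  have hsplit : ∀ m : Fin (2 * n), ∃ i : Fin n,
      m = ⟨2 * (i : ℕ), by omega⟩ ∨ m = ⟨2 * (i : ℕ) + 1, by omega⟩ := by
    intro m
    refine ⟨⟨m / 2, by omega⟩, ?_⟩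
    rcases Nat.even_or_odd' m with ⟨c, hc | hc⟩
    · left; ext; simp only; omega
    · right; ext; simp only; omega
  have hspan : ∀ (w : Fin n → M) (a : Module.Basis (Fin (2 * n)) ℝ M),
      (∀ i : Fin n, a ⟨2 * (i : ℕ), by omega⟩ = w i ∧
        a ⟨2 * (i : ℕ) + 1, by omega⟩ = Complex.I • w i) →
      ⊤ ≤ Submodule.span ℂ (Set.range w) := by
    intro w a ha x _
    rw [← a.sum_repr x]
    refine Submodule.sum_mem _ fun m _ => ?_
    rw [← algebraMap_smul ℂ (a.repr x m)]
    refine Submodule.smul_mem _ _ ?_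
    obtain ⟨i, rfl | rfl⟩ := hsplit m
    · rw [(ha i).1]; exact Submodule.subset_span ⟨i, rfl⟩
    · rw [(ha i).2]; exact Submodule.smul_mem _ _ (Submodule.subset_span ⟨i, rfl⟩)
  let c := basisOfTopLeSpanOfCardEqFinrank v (hspan v b hb) (by simp [hrank])
  let c' := basisOfTopLeSpanOfCardEqFinrank v' (hspan v' b' hb') (by simp [hrank])
  let f : M ≃ₗ[ℂ] M := c.equiv c' (Equiv.refl _)
  have hf : ∀ i, f (v i) = v' i := fun i => by
    have := c.equiv_apply i c' (Equiv.refl _)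
    simpa [c, c'] using this
  have hmap : b.map (f.restrictScalars ℝ) = b' := by
    refine Module.Basis.eq_of_apply_eq fun m => ?_
    rw [Module.Basis.map_apply, LinearEquiv.restrictScalars_apply]
    obtain ⟨i, rfl | rfl⟩ := hsplit m
    · rw [(hb i).1, (hb' i).1, hf]
    · rw [(hb i).2, (hb' i).2, map_smul, hf]
  rw [← hmap, Module.Basis.orientation_map, eq_comm, Orientation.map_eq_iff_det_pos _ _
    (Module.finrank_eq_card_basis b).symm]
  have hdet : LinearMap.det ((f.restrictScalars ℝ : M ≃ₗ[ℝ] M) : M →ₗ[ℝ] M)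
      = Algebra.norm ℝ (LinearMap.det (f : M →ₗ[ℂ] M)) :=
    LinearMap.det_restrictScalars (R := ℝ) (S := ℂ) (f := (f : M →ₗ[ℂ] M))
  rw [hdet, Algebra.norm_complex_apply]
  exact Complex.normSq_pos.2 (LinearEquiv.isUnit_det' f).ne_zero

lemma IsComplexOrientation.unique {T : Submodule ℝ E} {n : ℕ}
    {o o' : Orientation ℝ (E ⧸ T) (Fin (2 * n))}
    (h : IsComplexOrientation T n o) (h' : IsComplexOrientation T n o') : o = o' := by
  obtain ⟨hT, v, b, hb, rfl⟩ := h
  obtain ⟨-, v', b', hb', rfl⟩ := h'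
  obtain ⟨T', rfl⟩ : ∃ T' : Submodule ℂ E, T = T'.restrictScalars ℝ := ⟨
    { T.toAddSubmonoid with
      smul_mem' := fun c x hx => by
        have hx : x ∈ T := hx
        change c • x ∈ T
        have : c • x = c.re • x + c.im • Complex.I • x := by
          conv_lhs => rw [← Complex.re_add_im c]
          rw [add_smul, mul_smul]
          exact congrArg₂ (· + ·) (algebraMap_smul ℂ c.re x)
            (algebraMap_smul ℂ c.im (Complex.I • x))
        rw [this]
        exact T.add_mem (T.smul_mem _ hx) (T.smul_mem _ (hT x hx)) }, rfl⟩
  let r : (E ⧸ T'.restrictScalars ℝ) ≃ₗ[ℝ] (E ⧸ T') := Submodule.Quotient.restrictScalarsEquiv ℝ T'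
  have := orientation_eq_of_complex (fun i => Submodule.Quotient.mk (v i))
    (fun i => Submodule.Quotient.mk (v' i)) (b.map r) (b'.map r)
    (fun i => ?_) (fun i => ?_)
  · rw [Module.Basis.orientation_map, Module.Basis.orientation_map] at this
    exact (Orientation.map _ r).injective this
  · rw [Module.Basis.map_apply, Module.Basis.map_apply, (hb i).1, (hb i).2]
    exact ⟨rfl, rfl⟩
  · rw [Module.Basis.map_apply, Module.Basis.map_apply, (hb' i).1, (hb' i).2]
    exact ⟨rfl, rfl⟩

lemma exists_isComplexOrientation {F : Submodule ℂ E} {n : ℕ}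
    [FiniteDimensional ℂ (E ⧸ F)] (hn : Module.finrank ℂ (E ⧸ F) = n) :
    ∃ o, IsComplexOrientation (F.restrictScalars ℝ) n o := by
  let c : Module.Basis (Fin n) ℂ (E ⧸ F) := Module.finBasisOfFinrankEq ℂ _ hn
  let r : (E ⧸ F.restrictScalars ℝ) ≃ₗ[ℝ] (E ⧸ F) := Submodule.Quotient.restrictScalarsEquiv ℝ F
  -- `finProdFinEquiv` sends `(i, s)` to `s + 2 * i`.
  let eqv : Fin 2 × Fin n ≃ Fin (2 * n) :=
    (Equiv.prodComm _ _).trans (finProdFinEquiv.trans (finCongr (mul_comm n 2)))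
  let b : Module.Basis (Fin (2 * n)) ℝ (E ⧸ F.restrictScalars ℝ) :=
    ((Complex.basisOneI.smulTower c).reindex eqv).map r.symm
  have hv : ∀ i, ∃ v : E, Submodule.Quotient.mk v = c i := fun i =>
    Submodule.Quotient.mk_surjective F (c i)
  choose v hv using hv
  have h0 : ∀ i : Fin n, eqv (0, i) = ⟨2 * (i : ℕ), by omega⟩ := fun i => by
    ext; simp [eqv]
  have h1 : ∀ i : Fin n, eqv (1, i) = ⟨2 * (i : ℕ) + 1, by omega⟩ := fun i => by
    ext; simp [eqv]; omega
  refine ⟨b.orientation, fun x hx => F.smul_mem Complex.I hx, v, b, fun i => ⟨?_, ?_⟩, rfl⟩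
  · apply r.injective
    rw [← h0]
    simp [b, Module.Basis.smulTower_apply, ← hv]
    rfl
  · apply r.injective
    rw [← h1]
    simp [b, Module.Basis.smulTower_apply, ← hv]
    rfl

lemma IsComplexOrientation.map {T F : Submodule ℝ E} {n : ℕ}
    {o : Orientation ℝ (E ⧸ T) (Fin (2 * n))} (h : IsComplexOrientation T n o)
    (L : E →ₗ[ℂ] E) (hF : ∀ x ∈ F, Complex.I • x ∈ F) (f : (E ⧸ T) ≃ₗ[ℝ] (E ⧸ F))
    (hf : ∀ v, f (Submodule.Quotient.mk v) = Submodule.Quotient.mk (L v)) :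
    IsComplexOrientation F n (Orientation.map (Fin (2 * n)) f o) := by
  obtain ⟨hT, v, b, hb, rfl⟩ := h
  refine ⟨hF, fun i => L (v i), b.map f, fun i => ?_, Module.Basis.orientation_map b f⟩
  rw [Module.Basis.map_apply, Module.Basis.map_apply, (hb i).1, (hb i).2, hf, hf, map_smul]
  exact ⟨rfl, rfl⟩

end ComplexOrientation

/-! ### Charts that straighten the exact strata -/

namespace SchubertType

/-- The `i < j_q` that are not entries of `J`. -/
def gaps (J : SchubertType) (q : Fin J.length) : Finset ℕ :=
  (Finset.range (J.entry q)).filter fun i => ∀ p, J.entry p ≠ i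

lemma mem_gaps {J : SchubertType} {q : Fin J.length} {i : ℕ} :
    i ∈ J.gaps q ↔ i < J.entry q ∧ ∀ p, J.entry p ≠ i := by
  simp [gaps]

lemma card_gaps (J : SchubertType) (q : Fin J.length) :
    ((J.gaps q).card : ℤ) = J.entry q - (q : ℕ) := by
  have h1 := Finset.card_filter_add_card_filter_not (s := Finset.range (J.entry q))
    (fun i => ∀ p, J.entry p ≠ i)
  have h2 : ((Finset.range (J.entry q)).filter fun i => ¬ ∀ p, J.entry p ≠ i)
      = (Finset.Iio q).map ⟨J.entry, J.strictMono.injective⟩ := by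
    ext i
    simp only [Finset.mem_filter, Finset.mem_range, Finset.mem_map, Finset.mem_Iio,
      Function.Embedding.coeFn_mk, not_forall, not_not]
    constructor
    · rintro ⟨hi, p, rfl⟩
      exact ⟨p, J.strictMono.lt_iff_lt.1 hi, rfl⟩
    · rintro ⟨p, hp, rfl⟩
      exact ⟨J.strictMono hp, p, rfl⟩
  rw [h2, Finset.card_map, Fin.card_Iio, Finset.card_range] at h1
  change (J.gaps q).card + _ = _ at h1
  omega

end SchubertType

section LocalChart

variable {H : Type*} [NormedAddCommGroup H] [InnerProductSpace ℂ H]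

/-- The equations of the exact stratum of type `J` in block coordinates `Y`, which are linear: the
Schur complement vanishes, and, for each vector `f_q` of an echelon basis of `Ker t`, the components
along `e_i`, `i` a gap below `j_q`, of the value of the slope at `f_q` vanish. -/
def stratumEquations (t g : H →L[ℂ] H) (J : SchubertType) (e : ℕ → H) (f : Fin J.length → H) :
    (H →L[ℂ] H) →ₗ[ℂ] (t.ker →ₗ[ℂ] (1 - t * g).range) × (∀ q, J.gaps q → ℂ) :=
  LinearMap.prod
    { toFun := fun Y => (1 - t * g : H →L[ℂ] H).toLinearMap.rangeRestrict ∘ₗ Y.toLinearMap ∘ₗ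
        t.ker.subtype
      map_add' := fun Y Z => LinearMap.ext fun z => Subtype.ext <|
        map_add (1 - t * g) (Y z) (Z z)
      map_smul' := fun c Y => LinearMap.ext fun z => Subtype.ext <|
        map_smul (1 - t * g) c (Y z) }
    (LinearMap.pi fun q => LinearMap.pi fun i =>
      { toFun := fun Y => inner ℂ (e i) (g (Y (f q)))
        map_add' := fun Y Z => by simp
        map_smul' := fun c Y => by simp })

lemma mem_ker_stratumEquations {t g : H →L[ℂ] H} {J : SchubertType} {e : ℕ → H}
    {f : Fin J.length → H} {Y : H →L[ℂ] H} :
    Y ∈ LinearMap.ker (stratumEquations t g J e f) ↔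
      (∀ z : t.ker, (1 - t * g) (Y z) = 0) ∧
        ∀ q, ∀ i : J.gaps q, inner ℂ (e i) (g (Y (f q))) = 0 := by
  rw [LinearMap.mem_ker, Prod.ext_iff]
  refine and_congr ?_ ?_
  · rw [LinearMap.ext_iff]
    exact forall_congr' fun z => Subtype.ext_iff
  · rw [funext_iff]
    exact forall_congr' fun q => funext_iff

lemma isClosed_ker_stratumEquations (t g : H →L[ℂ] H) (J : SchubertType) (e : ℕ → H)
    (f : Fin J.length → H) :
    IsClosed (LinearMap.ker (stratumEquations t g J e f) : Set (H →L[ℂ] H)) := by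
  have : (LinearMap.ker (stratumEquations t g J e f) : Set (H →L[ℂ] H))
      = (⋂ z : t.ker, {Y | (1 - t * g) (Y z) = 0}) ∩
        ⋂ q, ⋂ i : J.gaps q, {Y | inner ℂ (e i) (g (Y (f q))) = 0} := by
    ext Y
    rw [SetLike.mem_coe, mem_ker_stratumEquations]
    simp only [Set.mem_inter_iff, Set.mem_iInter]
    rfl
  rw [this]
  refine IsClosed.inter (isClosed_iInter fun z => isClosed_eq (by fun_prop) (by fun_prop))
    (isClosed_iInter fun q => isClosed_iInter fun i => isClosed_eq ?_ (by fun_prop))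
  exact Continuous.inner continuous_const (by fun_prop)

variable {W : CompleteFlag H} {e : ℕ → H} {J : SchubertType}

/-- A reduced echelon basis of a subspace `V` of type `J`: `f_q` lies in `V ∩ W_{j_q}`, and `f` is
dual to the functionals `⟪e_{j_p}, ·⟫`. -/
structure IsEchelonBasis (W : CompleteFlag H) (e : ℕ → H) (V : Submodule ℂ H) (J : SchubertType)
    (f : Fin J.length → H) : Prop where
  mem : ∀ q, f q ∈ V
  mem_W : ∀ q, f q ∈ W.W (J.entry q)
  inner_eq : ∀ p q, inner ℂ (e (J.entry p)) (f q) = if p = q then 1 else 0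

/-- The projection onto the span of an echelon basis along the common kernel of the functionals
`⟪e_{j_p}, ·⟫`. With this complement of `Ker t`, adding the slope to an echelon basis of `Ker t`
keeps it reduced. -/
def echelonProj (e : ℕ → H) (J : SchubertType) (f : Fin J.length → H) : H →L[ℂ] H :=
  ∑ q, (innerSL ℂ (e (J.entry q))).smulRight (f q)

lemma sum_smulRight_apply (c : Fin J.length → H) (v : H) :
    (∑ q, (innerSL ℂ (e (J.entry q))).smulRight (c q)) v
      = ∑ q, inner ℂ (e (J.entry q)) v • c q := by
  simp

namespace IsEchelonBasis

variable {V : Submodule ℂ H} {f : Fin J.length → H} (hf : IsEchelonBasis W e V J f)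
include hf

lemma sum_apply (c : Fin J.length → H) (q : Fin J.length) :
    (∑ q, (innerSL ℂ (e (J.entry q))).smulRight (c q)) (f q) = c q := by
  rw [sum_smulRight_apply]
  simp [hf.inner_eq]

lemma inner_echelonProj (p : Fin J.length) (v : H) :
    inner ℂ (e (J.entry p)) (echelonProj e J f v) = inner ℂ (e (J.entry p)) v := by
  rw [echelonProj, sum_smulRight_apply, inner_sum]
  simp [inner_smul_right, hf.inner_eq]

lemma echelonProj_mem (v : H) : echelonProj e J f v ∈ V := by
  rw [echelonProj, sum_smulRight_apply]
  exact V.sum_mem fun q _ => V.smul_mem _ (hf.mem q)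

lemma echelonProj_apply (he : IsAdaptedSequence W e) (hV : HasExactType W V J) {v : H}
    (hv : v ∈ V) : echelonProj e J f v = v := by
  rw [← sub_eq_zero]
  refine he.eq_zero_of_inner_entry hV (V.sub_mem (hf.echelonProj_mem v) hv) fun p => ?_
  rw [inner_sub_right, hf.inner_echelonProj, sub_self]

end IsEchelonBasis

lemma IsAdaptedSequence.exists_isEchelonBasis (he : IsAdaptedSequence W e) {V : Submodule ℂ H}
    (hV : HasExactType W V J) : ∃ f, IsEchelonBasis W e V J f := by
  choose f hf hf' using he.exists_echelon hV
  exact ⟨f, fun q => (hf q).1, fun q => (hf q).2, fun p q => hf' q p⟩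

variable {t g : H →L[ℂ] H} {f : Fin J.length → H}

lemma stratumEquations_surjective (he : IsAdaptedSequence W e) (hg : IsGeneralizedInverse t g)
    (ht : HasExactType W t.ker J) (hf : IsEchelonBasis W e t.ker J f)
    (hP : 1 - g * t = echelonProj e J f) :
    Function.Surjective (stratumEquations t g J e f) := by
  rintro ⟨A, y⟩
  let w : Fin J.length → H := fun q => ∑ i : J.gaps q, y q i • e i
  let F : Fin J.length → t.ker := fun q => ⟨f q, hf.mem q⟩
  let Y : H →L[ℂ] H := ∑ q, (innerSL ℂ (e (J.entry q))).smulRight ((A (F q) : H) + t (w q))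
  have hY : ∀ q, Y (f q) = A (F q) + t (w q) := hf.sum_apply _
  have hqA : ∀ c : (1 - t * g).range, (1 - t * g) (c : H) = c := by
    rintro ⟨_, v, rfl⟩
    exact congrArg (fun f : H →L[ℂ] H => f v) hg.q_mul_q
  have hgA : ∀ c : (1 - t * g).range, g (c : H) = 0 := by
    rintro ⟨_, v, rfl⟩
    exact congrArg (fun f : H →L[ℂ] H => f v) hg.g_mul_q
  have hqt : ∀ v, (1 - t * g) (t v) = 0 := fun v =>
    congrArg (fun f : H →L[ℂ] H => f v) hg.q_mul_t
  have hw : ∀ q, ∀ i : J.gaps q, inner ℂ (e i) (w q) = y q i := fun q i =>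
    (he.orthonormal.comp _ Subtype.val_injective).inner_right_fintype (y q) i
  have hw' : ∀ p q, inner ℂ (e (J.entry p)) (w q) = 0 := by
    intro p q
    rw [inner_sum]
    refine Finset.sum_eq_zero fun i _ => ?_
    rw [inner_smul_right, he.orthonormal.2 ((SchubertType.mem_gaps.1 i.2).2 p), mul_zero]
  have hgt : ∀ q, g (t (w q)) = w q := by
    intro q
    have h1 : w q - g (t (w q)) = echelonProj e J f (w q) :=
      congrArg (fun f : H →L[ℂ] H => f (w q)) hP
    rw [echelonProj, sum_smulRight_apply, Finset.sum_eq_zero (fun p _ => by rw [hw', zero_smul]),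
      sub_eq_zero] at h1
    exact h1.symm
  refine ⟨Y, Prod.ext ?_ ?_⟩
  · refine LinearMap.ext fun z => Subtype.ext ?_
    change (1 - t * g) (Y z) = A z
    have hz : z = ∑ q, inner ℂ (e (J.entry q)) (z : H) • F q := by
      ext
      have := hf.echelonProj_apply he ht z.2
      rw [echelonProj, sum_smulRight_apply] at this
      simpa [F] using this.symm
    conv_rhs => rw [hz]
    rw [sum_smulRight_apply]
    simp only [map_sum, map_smul, map_add, hqA, hqt, add_zero]
    exact (map_sum (1 - t * g).range.subtype
      (fun q => inner ℂ (e (J.entry q)) (z : H) • A (F q)) Finset.univ).symm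
  · funext q i
    change inner ℂ (e i) (g (Y (f q))) = y q i
    rw [hY, map_add, hgA, hgt, zero_add, hw]

lemma finrank_quotient_ker_stratumEquations {k : ℕ} (he : IsAdaptedSequence W e)
    (hg : IsGeneralizedInverse t g) (htF : t ∈ Fred H k)
    (ht : HasExactType W t.ker J) (hf : IsEchelonBasis W e t.ker J f)
    (hP : 1 - g * t = echelonProj e J f) :
    FiniteDimensional ℂ ((H →L[ℂ] H) ⧸ LinearMap.ker (stratumEquations t g J e f)) ∧
    (Module.finrank ℂ ((H →L[ℂ] H) ⧸ LinearMap.ker (stratumEquations t g J e f)) : ℤ)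
      = J.N k := by
  have h1 := ht.finiteDimensional
  have h2 := hg.finiteDimensional_range_q htF.1
  let E := (stratumEquations t g J e f).quotKerEquivOfSurjective
    (stratumEquations_surjective he hg ht hf hP)
  refine ⟨E.symm.finiteDimensional, ?_⟩
  have h3 := Fred.length_eq htF
  rw [E.finrank_eq, Module.finrank_prod, Module.finrank_linearMap, Module.finrank_pi_fintype,
    hg.finrank_range_q, SchubertType.N]
  rw [ht.finrank_eq] at h3 ⊢
  push_cast
  congr 1
  · congr 1
    omega
  · refine Finset.sum_congr rfl fun q _ => ?_
    rw [Module.finrank_fintype_fun_eq_card, Fintype.card_coe, SchubertType.card_gaps]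

/-- Near `t` the dimensions of the intersections with the flag can only drop, and the kernel of `x`
has again type `J` if and only if it is the whole graph of the slope over `Ker t` and the vectors
`f_q + slope t g x (f_q)` form an echelon basis of it. -/
lemma mem_exactStratum_iff {k : ℕ} (he : IsAdaptedSequence W e)
    (hg : IsGeneralizedInverse t g) (htF : t ∈ Fred H k)
    (ht : HasExactType W t.ker J) (hf : IsEchelonBasis W e t.ker J f)
    (hP : 1 - g * t = echelonProj e J f) {x : H →L[ℂ] H} (hx : IsUnit (pivot t g x))
    (hle : ∀ j, Module.finrank ℂ (x.ker ⊓ W.W j : Submodule ℂ H) ≤ J.count j) :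
    x ∈ exactStratum W k J ↔
      blockChart t g x ∈ LinearMap.ker (stratumEquations t g J e f) := by
  have hxF := hg.mem_Fred htF hx
  have hfd := ht.finiteDimensional
  have hfdx := hxF.1.finite_ker
  have hslope : ∀ z, t z = 0 → slope t g x z = g (blockChart t g x z) := by
    intro z hz
    have : g (blockChart t g x ((1 - g * t) z)) = slope t g x z :=
      congrArg (fun f : H →L[ℂ] H => f z) (hg.g_mul_blockChart_mul_p hx)
    rw [← this, IsGeneralizedInverse.p_apply_of_mem_ker hz]
  have horth : ∀ p z, inner ℂ (e (J.entry p)) (slope t g x z) = 0 := by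
    intro p z
    have : (1 - g * t) (slope t g x z) = 0 :=
      congrArg (fun f : H →L[ℂ] H => f z) (hg.p_mul_slope hx)
    rw [← hf.inner_echelonProj, ← hP, this, inner_zero_right]
  rw [mem_ker_stratumEquations]
  constructor
  · rintro ⟨-, hxJ⟩
    constructor
    · have h1 := (hg.kerEquiv hx).finrank_eq
      rw [hxJ.finrank_eq, ← ht.finrank_eq] at h1
      have h2 := Submodule.eq_top_of_finrank_eq h1
      intro z
      exact (IsGeneralizedInverse.schur_eq_zero_iff z).1
        (h2 ▸ Submodule.mem_top : z ∈ LinearMap.ker _)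
    · intro q i
      obtain ⟨f', hf'⟩ := he.exists_isEchelonBasis hxJ
      obtain ⟨z, hz, -, hz'⟩ := (hg.apply_eq_iff hx (map_zero g) (f' q)).1 (hf'.mem q)
      have hzf : z = f q := by
        rw [← sub_eq_zero]
        refine he.eq_zero_of_inner_entry ht (t.ker.sub_mem hz (hf.mem q)) fun p => ?_
        have h1 := hf'.inner_eq p q
        rw [hz', inner_add_right, horth, add_zero] at h1
        rw [inner_sub_right, h1, hf.inner_eq, sub_self]
      have hi := (SchubertType.mem_gaps.1 i.2).1
      have h1 := (he.mem_iff _ _).1 (hf'.mem_W q) i hi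
      rw [hz', inner_add_right, hzf, (he.mem_iff _ _).1 (hf.mem_W q) i hi, zero_add,
        hslope _ (hf.mem q)] at h1
      exact h1
  · rintro ⟨h1, h2⟩
    refine ⟨hxF, HasExactType.of_finrank_inf hle fun q => ?_⟩
    refine IsAdaptedSequence.le_finrank_inf (e := e) (f := fun q => f q + slope t g x (f q))
      (fun q => ?_) (fun q => ?_) (fun p q => ?_) q
    · exact (hg.apply_eq_iff hx (map_zero g) _).2 ⟨f q, hf.mem q, h1 ⟨f q, hf.mem q⟩, rfl⟩
    · rw [he.mem_iff]
      intro i hi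
      rw [inner_add_right, (he.mem_iff _ _).1 (hf.mem_W q) i hi, zero_add]
      by_cases hgap : ∃ p, J.entry p = i
      · obtain ⟨p, rfl⟩ := hgap
        exact horth p _
      · rw [hslope _ (hf.mem q)]
        exact h2 q ⟨i, SchubertType.mem_gaps.2 ⟨hi, fun p hp => hgap ⟨p, hp⟩⟩⟩
    · rw [inner_add_right, horth, add_zero, hf.inner_eq]

lemma exists_chart_exactStratum [CompleteSpace H] {k : ℕ} (he : IsAdaptedSequence W e)
    {t : H →L[ℂ] H} (ht : t ∈ exactStratum W k J) :
    ∃ (φ : OpenPartialHomeomorph (H →L[ℂ] H) (H →L[ℂ] H)) (F : Submodule ℂ (H →L[ℂ] H)),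
      t ∈ φ.source ∧
      (∀ x ∈ φ.source, x ∈ Fred H k ∧
        (∀ j, Module.finrank ℂ (x.ker ⊓ W.W j : Submodule ℂ H) ≤ J.count j) ∧
        ContDiffAt ℂ ∞ φ x ∧ (x ∈ exactStratum W k J ↔ φ x ∈ F)) ∧
      ContDiff ℂ ∞ φ.symm ∧
      IsClosed (F : Set (H →L[ℂ] H)) ∧ FiniteDimensional ℂ ((H →L[ℂ] H) ⧸ F) ∧
      (Module.finrank ℂ ((H →L[ℂ] H) ⧸ F) : ℤ) = J.N k := by
  obtain ⟨htF, htJ⟩ := ht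
  obtain ⟨f, hf⟩ := he.exists_isEchelonBasis htJ
  obtain ⟨g, hg, hP⟩ := exists_isGeneralizedInverse htF.1 (P := echelonProj e J f)
    (fun v => hf.echelonProj_mem v) (fun v hv => hf.echelonProj_apply he htJ hv)
  obtain ⟨O, hO, hOo, htO⟩ := eventually_nhds_iff.1
    (he.eventually_forall_finrank_inf_le htF.1)
  have hdim := finrank_quotient_ker_stratumEquations he hg htF htJ hf hP
  have hcount : ∀ x ∈ O, ∀ j, Module.finrank ℂ (x.ker ⊓ W.W j : Submodule ℂ H) ≤ J.count j :=
    fun x hx j => (hO x hx j).trans_eq (((hasExactType_iff W).1 htJ).2 j)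
  refine ⟨hg.chart.restrOpen O hOo, LinearMap.ker (stratumEquations t g J e f), ?_, ?_, ?_,
    isClosed_ker_stratumEquations t g J e f, hdim.1, hdim.2⟩
  · rw [OpenPartialHomeomorph.restrOpen_source]
    refine ⟨?_, htO⟩
    change IsUnit (pivot t g t)
    rw [pivot_self hg]
    exact isUnit_one
  · intro x hx
    rw [OpenPartialHomeomorph.restrOpen_source] at hx
    exact ⟨hg.mem_Fred htF hx.1, hcount x hx.2, contDiffAt_blockChart ℂ hx.1,
      mem_exactStratum_iff he hg htF htJ hf hP hx.1 (hcount x hx.2)⟩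
  · exact contDiff_blockChartSymm ℂ

end LocalChart

/-! ### The strata of the standard filtration -/

section Strata

variable {H : Type*} [NormedAddCommGroup H] [InnerProductSpace ℂ H]
variable {W : CompleteFlag H} {e : ℕ → H} {k : ℕ} {lam : Fin k → ℕ}

lemma le_length_of_hasExactType {T : H →L[ℂ] H} {J : SchubertType} (hT : T ∈ Fred H k)
    (hJ : HasExactType W T.ker J) : k ≤ J.length := by
  have := Fred.length_eq hT
  rw [hJ.finrank_eq] at this
  omega

lemma mem_locus_iff {T : H →L[ℂ] H} {J : SchubertType} (hT : T ∈ Fred H k)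
    (hJ : HasExactType W T.ker J) : T ∈ locus W lam ↔ J.Dominates lam := by
  rw [SchubertType.dominates_iff_count (le_length_of_hasExactType hT hJ)]
  have hc := ((hasExactType_iff W).1 hJ).2
  constructor
  · rintro ⟨-, h⟩ i
    rw [← hc]; exact h i
  · intro h
    exact ⟨hT, fun i => by rw [hc]; exact h i⟩

/-- `ofPartition lam` is the only type of minimal `N_k` among those that dominate `lam`. -/
lemma sum_le_N (hlam : Antitone lam) {J : SchubertType} (hJ : J.Dominates lam) :
    ((∑ i, lam i : ℕ) : ℤ) ≤ J.N k ∧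
      (J.N k = (∑ i, lam i : ℕ) → J = SchubertType.ofPartition lam hlam) := by
  have h := SchubertType.N_le_N (k := k) (le_refl (SchubertType.ofPartition lam hlam).length)
    ((SchubertType.dominates_iff hlam).1 hJ)
  rw [SchubertType.N_ofPartition hlam] at h
  exact ⟨h.1, fun hN => (h.2 hN.symm).symm⟩

lemma standardFiltration_odd_eq (l : ℕ) :
    standardFiltration W lam (2 * l + 1) = standardFiltration W lam (2 * l + 2) := by
  simp only [standardFiltration]
  rw [show 2 * l / 2 = (2 * l + 1) / 2 by omega]

lemma mem_standardFiltration_iff (hlam : Antitone lam)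
    {T : H →L[ℂ] H} {J : SchubertType} (hT : T ∈ Fred H k)
    (hJ : HasExactType W T.ker J) (m : ℕ) :
    T ∈ standardFiltration W lam m ↔
      J.Dominates lam ∧ (∑ i, lam i : ℕ) + (((m + 1) / 2 : ℕ) : ℤ) ≤ J.N k := by
  cases m with
  | zero =>
    change T ∈ locus W lam ↔ _
    rw [mem_locus_iff hT hJ]
    refine ⟨fun h => ⟨h, by simpa using (sum_le_N hlam h).1⟩, fun h => h.1⟩
  | succ n =>
    change (T ∈ locus W lam ∧ _) ↔ _
    rw [mem_locus_iff hT hJ, show (n + 1 + 1) / 2 = n / 2 + 1 by omega]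
    refine and_congr_right fun _ => ⟨?_, fun h => ⟨J, hJ, h⟩⟩
    rintro ⟨J', hJ', h⟩
    rwa [hJ.unique W hJ']

lemma standardFiltration_subset (m : ℕ) : standardFiltration W lam m ⊆ Fred H k := by
  cases m with
  | zero => exact fun T hT => hT.1
  | succ n => exact fun T hT => hT.1.1

lemma standardFiltration_antitone (he : IsAdaptedSequence W e) (hlam : Antitone lam) :
    Antitone (standardFiltration W lam) := by
  intro m n hmn T hT
  have hTF := standardFiltration_subset n hT
  have := hTF.1.finite_ker
  obtain ⟨J, hJ⟩ := he.exists_hasExactType T.ker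
  rw [mem_standardFiltration_iff hlam hTF hJ] at hT ⊢
  refine ⟨hT.1, le_trans ?_ hT.2⟩
  have : (m + 1) / 2 ≤ (n + 1) / 2 := by omega
  gcongr

lemma isClosed_standardFiltration [CompleteSpace H] (he : IsAdaptedSequence W e)
    (hlam : Antitone lam) (m : ℕ) :
    IsClosed (Subtype.val ⁻¹' standardFiltration W lam m : Set (Fred H k)) := by
  rw [← isOpen_compl_iff, isOpen_iff_mem_nhds]
  rintro ⟨T, hT⟩ hTm
  have hev := he.eventually_forall_finrank_inf_le hT.1
  have := hT.1.finite_ker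
  obtain ⟨J, hJ⟩ := he.exists_hasExactType T.ker
  filter_upwards [continuous_subtype_val.continuousAt.eventually hev] with ⟨T', hT'⟩ hle hmem
  refine hTm ?_
  have := hT'.1.finite_ker
  obtain ⟨J', hJ'⟩ := he.exists_hasExactType T'.ker
  have hcount : ∀ j, J'.count j ≤ J.count j := fun j => by
    rw [← ((hasExactType_iff W).1 hJ).2, ← ((hasExactType_iff W).1 hJ').2]
    exact hle j
  change T' ∈ standardFiltration W lam m at hmem
  change T ∈ standardFiltration W lam m
  rw [mem_standardFiltration_iff hlam hT' hJ'] at hmem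
  rw [mem_standardFiltration_iff hlam hT hJ]
  exact ⟨(SchubertType.dominates_iff hlam).2 fun j =>
      ((SchubertType.dominates_iff hlam).1 hmem.1 j).trans (hcount j),
    hmem.2.trans (SchubertType.N_le_N (le_length_of_hasExactType hT' hJ') hcount).1⟩

lemma mem_stratum_even_iff (hlam : Antitone lam)
    {T : H →L[ℂ] H} {J : SchubertType} (hT : T ∈ Fred H k)
    (hJ : HasExactType W T.ker J) (l : ℕ) :
    T ∈ standardFiltration W lam (2 * l) \ standardFiltration W lam (2 * l + 1) ↔
      J.Dominates lam ∧ J.N k = (∑ i, lam i : ℕ) + (l : ℤ) := by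
  rw [Set.mem_sdiff, mem_standardFiltration_iff hlam hT hJ,
    mem_standardFiltration_iff hlam hT hJ, show (2 * l + 1) / 2 = l by omega,
    show (2 * l + 1 + 1) / 2 = l + 1 by omega]
  push_cast
  constructor
  · rintro ⟨⟨h1, h2⟩, h3⟩
    refine ⟨h1, le_antisymm ?_ h2⟩
    by_contra hlt
    exact h3 ⟨h1, by omega⟩
  · rintro ⟨h1, h2⟩
    exact ⟨⟨h1, h2.ge⟩, fun h => by have := h.2; omega⟩

lemma stratum_even_eq (he : IsAdaptedSequence W e) (hlam : Antitone lam) (l : ℕ) :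
    standardFiltration W lam (2 * l) \ standardFiltration W lam (2 * l + 1)
      = ⋃ J ∈ {J : SchubertType | J.Dominates lam ∧ J.N k = (∑ i, lam i : ℕ) + (l : ℤ)},
          exactStratum W k J := by
  ext T
  simp only [Set.mem_iUnion]
  constructor
  · intro hT
    have hTF := standardFiltration_subset _ hT.1
    have := hTF.1.finite_ker
    obtain ⟨J, hJ⟩ := he.exists_hasExactType T.ker
    exact ⟨J, (mem_stratum_even_iff hlam hTF hJ l).1 hT, hTF, hJ⟩
  · rintro ⟨J, hJ, hTF, hTJ⟩
    exact (mem_stratum_even_iff hlam hTF hTJ l).2 hJ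

/-- The strata of all types with a given `N_k` form a submanifold together: near a point of type `J`
the types are at most `J`, and by `SchubertType.N_le_N` only `J` itself has the same `N_k`. -/
lemma exists_adaptedChart [CompleteSpace H] (he : IsAdaptedSequence W e) (hlam : Antitone lam)
    (l : ℕ) {T : H →L[ℂ] H}
    (hT : T ∈ standardFiltration W lam (2 * l) \ standardFiltration W lam (2 * l + 1)) :
    ∃ (φ : OpenPartialHomeomorph (H →L[ℂ] H) (H →L[ℂ] H)) (F : Submodule ℂ (H →L[ℂ] H)),
      T ∈ φ.source ∧
      IsAdaptedChart (Fred H k)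
        (standardFiltration W lam (2 * l) \ standardFiltration W lam (2 * l + 1)) φ
        (F.restrictScalars ℝ) ∧
      (∀ x ∈ φ.source, DifferentiableAt ℂ φ x) ∧
      FiniteDimensional ℂ ((H →L[ℂ] H) ⧸ F) ∧
      Module.finrank ℂ ((H →L[ℂ] H) ⧸ F) = (∑ i, lam i) + l := by
  have hTF := standardFiltration_subset _ hT.1
  have := hTF.1.finite_ker
  obtain ⟨J, hJ⟩ := he.exists_hasExactType T.ker
  have hJl := (mem_stratum_even_iff hlam hTF hJ l).1 hT
  obtain ⟨φ, F, hTφ, hφ, hsymm, hFc, hFd, hFr⟩ := exists_chart_exactStratum he ⟨hTF, hJ⟩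
  refine ⟨φ, F, hTφ, ⟨fun x hx => (hφ x hx).1, ?_, ?_, hFc, fun x hx => ?_⟩, ?_, hFd, ?_⟩
  · exact ContDiffOn.restrict_scalars ℝ fun x hx => (hφ x hx).2.2.1.contDiffWithinAt
  · exact (hsymm.restrict_scalars ℝ).contDiffOn
  · obtain ⟨hxF, hle, -, hiff⟩ := hφ x hx
    change _ ↔ φ x ∈ F
    rw [← hiff]
    have := hxF.1.finite_ker
    obtain ⟨J', hJ'⟩ := he.exists_hasExactType x.ker
    rw [mem_stratum_even_iff hlam hxF hJ']
    constructor
    · rintro ⟨-, h2⟩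
      have h3 := (SchubertType.N_le_N (k := k) (le_length_of_hasExactType hxF hJ') fun j => by
        rw [← ((hasExactType_iff W).1 hJ').2]; exact hle j).2 (h2.trans hJl.2.symm)
      exact ⟨hxF, h3 ▸ hJ'⟩
    · rintro ⟨-, h⟩
      rwa [hJ'.unique W h]
  · exact fun x hx => (hφ x hx).2.2.1.differentiableAt (by simp)
  · rw [hJl.2] at hFr
    exact_mod_cast hFr

lemma rank_real_quotient {E : Type*} [NormedAddCommGroup E] [NormedSpace ℝ E] [NormedSpace ℂ E]
    [IsScalarTower ℝ ℂ E] (F : Submodule ℂ E) [FiniteDimensional ℂ (E ⧸ F)] :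
    Module.rank ℝ (E ⧸ F.restrictScalars ℝ) = ((2 * Module.finrank ℂ (E ⧸ F) : ℕ) : Cardinal) := by
  rw [(Submodule.Quotient.restrictScalarsEquiv ℝ F).rank_eq]
  have : FiniteDimensional ℝ (E ⧸ F) := Module.Finite.trans ℂ _
  rw [← Module.finrank_eq_rank, ← Module.finrank_mul_finrank ℝ ℂ, Complex.finrank_real_complex]

end Strata

/-! ### The coorientation -/

section Coorientation

variable {E : Type*} [NormedAddCommGroup E] [NormedSpace ℝ E] [NormedSpace ℂ E]
  [IsScalarTower ℝ ℂ E]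

/-- A subset with holomorphic charts that straighten it to complex subspaces has complex normal
spaces, and their canonical orientations orient the normal bundle, because the trivializations are
complex linear. -/
lemma exists_complex_normalOrientation {X S : Set E} {n : ℕ}
    (h : ∀ p ∈ S, ∃ (φ : OpenPartialHomeomorph E E) (F : Submodule ℂ E), p ∈ φ.source ∧
      IsAdaptedChart X S φ (F.restrictScalars ℝ) ∧ (∀ x ∈ φ.source, DifferentiableAt ℂ φ x) ∧
      FiniteDimensional ℂ (E ⧸ F) ∧ Module.finrank ℂ (E ⧸ F) = n) :
    ∃ orient : ∀ p : S, Orientation ℝ (NormalSpace S (p : E)) (Fin (2 * n)),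
      IsNormalOrientation X S (2 * n) orient ∧
      ∀ p, IsComplexOrientation _ n (orient p) := by
  have hfd : ∀ {φ : OpenPartialHomeomorph E E} {x : E}, DifferentiableAt ℂ φ x →
      ∀ v, fderiv ℝ φ x v = fderiv ℂ φ x v := fun hd v => by
    rw [hd.fderiv_restrictScalars ℝ]; rfl
  have hex : ∀ p : S, ∃ o : Orientation ℝ (NormalSpace S (p : E)) (Fin (2 * n)),
      IsComplexOrientation _ n o := by
    rintro ⟨p, hp⟩
    obtain ⟨φ, F, hpφ, hφ, hd, hF, hn⟩ := h p hp
    obtain ⟨o, ho⟩ := exists_isComplexOrientation hn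
    have hd' := hfd (hd p hpφ)
    let L : E ≃ₗ[ℂ] E := LinearEquiv.ofBijective (fderiv ℂ φ p).toLinearMap
      ⟨fun v w hvw => (Function.LeftInverse.injective (hφ.fderiv_symm_fderiv hpφ))
        (by rw [hd', hd']; exact hvw),
      fun v => by
        obtain ⟨w, hw⟩ := hφ.fderiv_surjective hpφ v
        exact ⟨w, (hd' w).symm.trans hw⟩⟩
    refine ⟨_, ho.map L.symm.toLinearMap (fun x hx => ?_) (hφ.normalEquiv hpφ hp).symm fun v => ?_⟩
    · rw [hφ.tangentSubspace_eq hpφ hp] at hx ⊢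
      change fderiv ℝ φ p (Complex.I • x) ∈ F
      rw [hd', map_smul, ← hd']
      exact F.smul_mem _ hx
    · rw [LinearEquiv.symm_apply_eq, hφ.normalEquiv_mk, hd']
      exact congrArg _ (L.apply_symm_apply v).symm
  choose orient horient using hex
  refine ⟨orient, fun p => ?_, horient⟩
  obtain ⟨φ, F, hpφ, hφ, hd, hF, hn⟩ := h p p.2
  have hmap : ∀ (q : S) (hq : (q : E) ∈ φ.source), IsComplexOrientation (F.restrictScalars ℝ) n
      (Orientation.map (Fin (2 * n)) (hφ.normalEquiv hq q.2) (orient q)) := fun q hq =>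
    (horient q).map (fderiv ℂ φ q).toLinearMap (fun x hx => F.smul_mem Complex.I hx) _
      fun v => by rw [hφ.normalEquiv_mk, hfd (hd q hq)]; rfl
  exact ⟨φ, _, hpφ, hφ, _, fun q hq => ⟨hφ.normalEquiv hq q.2, hφ.normalEquiv_mk hq q.2,
    (hmap q hq).unique (hmap p hpφ)⟩⟩

end Coorientation

end SchurKoschorke

end

theorem mainTheorem10 {H : Type*} [NormedAddCommGroup H] [InnerProductSpace ℂ H] [CompleteSpace H]
    [TopologicalSpace.SeparableSpace H] (hH : ¬ FiniteDimensional ℂ H)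
    (W : SchurKoschorke.CompleteFlag H) (k : ℕ) (lam : Fin k → ℕ) (hlam : Antitone lam) :
    ∃ Q : SchurKoschorke.CoorientedQuasiManifold (SchurKoschorke.Fred H k)
        (SchurKoschorke.locus W lam) (2 * ∑ i, lam i),
      -- the filtration is the one by exact Schubert types
      Q.filtration = SchurKoschorke.standardFiltration W lam ∧
      Pairwise (Function.onFun Disjoint (SchurKoschorke.exactStratum W k)) ∧
      (∀ l : ℕ, Q.S (2 * l + 1) = ∅ ∧
        Q.S (2 * l) = ⋃ J ∈ {J : SchurKoschorke.SchubertType |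
            J.Dominates lam ∧ J.N k = (∑ i, lam i : ℕ) + (l : ℤ)},
          SchurKoschorke.exactStratum W k J) ∧
      -- the top stratum
      Q.S 0 = SchurKoschorke.exactStratum W k (SchurKoschorke.SchubertType.ofPartition lam hlam) ∧
      Q.S 0 = {T | T ∈ SchurKoschorke.Fred H k ∧ Module.finrank ℂ T.ker = k ∧
        Module.finrank ℂ (H ⧸ T.range) = 0 ∧ Function.Surjective T ∧
        SchurKoschorke.HasExactType W T.ker
          (SchurKoschorke.SchubertType.ofPartition lam hlam)} ∧
      -- the coorientation is the one given by the complex structure of the normal bundle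
      (∀ T, SchurKoschorke.IsComplexOrientation _ (∑ i, lam i) (Q.coorientation T)) := by
  obtain ⟨e, he⟩ := SchurKoschorke.exists_isAdaptedSequence W
  obtain ⟨orient, horient, hcomplex⟩ :=
    SchurKoschorke.exists_complex_normalOrientation (X := SchurKoschorke.Fred H k)
      (S := SchurKoschorke.standardFiltration W lam 0 \ SchurKoschorke.standardFiltration W lam 1)
      (n := ∑ i, lam i) fun p hp => SchurKoschorke.exists_adaptedChart he hlam 0 hp
  have hodd : ∀ l, SchurKoschorke.standardFiltration W lam (2 * l + 1) \
      SchurKoschorke.standardFiltration W lam (2 * l + 1 + 1) = ∅ := fun l => by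
    rw [SchurKoschorke.standardFiltration_odd_eq, Set.sdiff_self]
  have htop : SchurKoschorke.standardFiltration W lam 0 \
      SchurKoschorke.standardFiltration W lam 1
        = SchurKoschorke.exactStratum W k (SchurKoschorke.SchubertType.ofPartition lam hlam) := by
    refine (SchurKoschorke.stratum_even_eq he hlam 0).trans (Set.Subset.antisymm ?_ ?_)
    · intro T hT
      simp only [Set.mem_iUnion] at hT
      obtain ⟨J, ⟨hJ, hN⟩, hT⟩ := hT
      rw [Nat.cast_zero, add_zero] at hN
      exact (SchurKoschorke.sum_le_N hlam hJ).2 hN ▸ hT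
    · intro T hT
      simp only [Set.mem_iUnion]
      exact ⟨_, ⟨(SchurKoschorke.SchubertType.dominates_iff hlam).2 fun _ => le_rfl,
        by rw [SchurKoschorke.SchubertType.N_ofPartition, Nat.cast_zero, add_zero]⟩, hT⟩
  refine ⟨
    { isOpen := SchurKoschorke.isOpen_Fred _
      subset := fun T hT => hT.1
      filtration := SchurKoschorke.standardFiltration W lam
      filtration_zero := rfl
      antitone := SchurKoschorke.standardFiltration_antitone he hlam
      isClosed := SchurKoschorke.isClosed_standardFiltration he hlam
      filtration_one := SchurKoschorke.standardFiltration_odd_eq 0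
      stratum := fun m => ?_
      coorientation := orient
      isNormalOrientation := horient },
    rfl, ?_, ?_, htop, htop.trans ?_, hcomplex⟩
  · rcases Nat.even_or_odd' m with ⟨l, rfl | rfl⟩
    · right
      refine ⟨fun T hT => SchurKoschorke.standardFiltration_subset _ hT.1, fun T hT => ?_⟩
      obtain ⟨φ, F, hTφ, hφ, -, hF, hn⟩ := SchurKoschorke.exists_adaptedChart he hlam l hT
      refine ⟨φ, _, hTφ, hφ, ?_⟩
      rw [SchurKoschorke.rank_real_quotient, hn, mul_add]
    · exact Or.inl (hodd l)
  · intro J J' hne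
    rw [Function.onFun, Set.disjoint_left]
    exact fun T hT hT' => hne (hT.2.unique W hT'.2)
  · exact fun l => ⟨hodd l, SchurKoschorke.stratum_even_eq he hlam l⟩
  · ext T
    constructor
    · rintro ⟨hTF, hT⟩
      have h1 : Module.finrank ℂ T.ker = k := hT.finrank_eq
      have h2 := SchurKoschorke.Fred.length_eq hTF
      have h3 : Module.finrank ℂ (H ⧸ T.range) = 0 := by omega
      have hfin : FiniteDimensional ℂ (H ⧸ T.range) := hTF.1.finite_coker
      refine ⟨hTF, h1, h3, ?_, hT⟩
      have h4 := Module.finrank_zero_iff.1 h3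
      exact LinearMap.range_eq_top.1 (Submodule.Quotient.subsingleton_iff.1 h4)
    · rintro ⟨hTF, -, -, -, hT⟩
      exact ⟨hTF, hT⟩
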